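/- Let $1\le m\le d$, let $\lambda=(\lambda_1,\dots,\lambda_d)$ and $\tau=(\tau_1,\dots,\tau_d)$ be real vectors, and for $r>0$ let $$f(\lambda,\tau,r)=\int_{S^{d-1}(r)}\exp\Bigl(\sum_{i=1}^d\lambda_it_i^2+\sum_{i=1}^d\tau_it_i\Bigr)\,d\mathbf t ,$$ where $S^{d-1}(r)=\{\mathbf t\in\mathbb R^d: t_1^2+\dots+t_d^2=r^2\}$ and $d\mathbf t$ is its volume element (of total mass $r^{d-1}S_{d-1}$; counting measure if $d=1$). Put $S_{m-1}=\mathrm{Vol}(S^{m-1}(1))=2\pi^{m/2}/\Gamma(m/2)$. Assume $$0>\lambda_1=\dots=\lambda_m>\lambda_{m+1}\ge\dots\ge\lambda_d .$$ Then the partial derivatives $\partial_{\lambda_j}f$ and $\partial_{\tau_j}f$ exist for all $r>0$, and the following holds, where $o(1)$ refers to $r\to\infty$ with $\lambda,\tau$ fixed. (a) If $\tau_1=\dots=\tau_m=0$, then \begin{align*} f(\lambda,\tau,r)&=r^{m-1}S_{m-1}\exp\Bigl(r^2\lambda_1-\sum_{i=m+1}^d\frac{\tau_i^2}{4(\lambda_i-\lambda_1)}\Bigr)\frac{\pi^{(d-m)/2}}{\prod_{i=m+1}^d(\lambda_1-\lambda_i)^{1/2}}(1+o(1)),\\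 \partial_{\lambda_j}f(\lambda,\tau,r)&=\frac{r^2}{m}f(\lambda,\tau,r)(1+o(1)),\quad j\le m,\\ \partial_{\tau_j}f(\lambda,\tau,r)&=0\ \text{ for all } r>0,\quad j\le m,\\ \partial_{\tau_j}f(\lambda,\tau,r)&=-\frac{\tau_j}{2(\lambda_j-\lambda_1)}f(\lambda,\tau,r)(1+o(1)),\quad j>m,\\ \partial_{\lambda_j}f(\lambda,\tau,r)&=\Bigl(\frac1{2(\lambda_1-\lambda_j)}+\frac{\tau_j^2}{4(\lambda_j-\lambda_1)^2}\Bigr)f(\lambda,\tau,r)(1+o(1)),\quad j>m. \end{align*} (b) If $(\tau_1,\dots,\tau_m)\ne(0,\dots,0)$ and $\gamma=(\tau_1^2+\dots+\tau_m^2)^{1/2}$, then \begin{align*} f(\lambda,\tau,r)&=\exp\Bigl(r^2\lambda_1+r\gamma-\sum_{i=m+1}^d\frac{\tau_i^2}{4(\lambda_i-\lambda_1)}\Bigr)\Bigl(\frac{2r}{\gamma}\Bigr)^{(m-1)/2}\frac{\pi^{(d-1)/2}}{\prod_{i=m+1}^d(\lambda_1-\lambda_i)^{1/2}}(1+o(1)),\\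 \partial_{\tau_j}f(\lambda,\tau,r)&=r\frac{\tau_j}{\gamma}f(\lambda,\tau,r)(1+o(1)),\quad j\le m,\ \tau_j\ne0,\\ \partial_{\lambda_j}f(\lambda,\tau,r)&=r^2\frac{\tau_j^2}{\gamma^2}f(\lambda,\tau,r)(1+o(1)),\quad j\le m,\ \tau_j\ne0,\\ \partial_{\tau_j}f(\lambda,\tau,r)&=0\ \text{ for all } r>0,\quad j\le m,\ \tau_j=0,\\ \partial_{\lambda_j}f(\lambda,\tau,r)&=\frac r\gamma f(\lambda,\tau,r)(1+o(1)),\quad j\le m,\ \tau_j=0,\\ \partial_{\tau_j}f(\lambda,\tau,r)&=-\frac{\tau_j}{2(\lambda_j-\lambda_1)}f(\lambda,\tau,r)(1+o(1)),\quad j>m,\\ \partial_{\lambda_j}f(\lambda,\tau,r)&=\Bigl(\frac1{2(\lambda_1-\lambda_j)}+\frac{\tau_j^2}{4(\lambda_j-\lambda_1)^2}\Bigr)f(\lambda,\tau,r)(1+o(1)),\quad j>m. \end{align*} -/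

import Mathlib

open MeasureTheory Filter Asymptotics

noncomputable section

namespace FisherBingham

/-- The volume element of the sphere `S^{d-1}(r)` of radius `r` centred at the origin, as a measure
on `ℝ^d`: the image of the surface measure of the unit sphere under `t ↦ r t`, times `r^{d-1}`.
(For `d = 1` it is the counting measure on `{r, -r}`.) -/
def sphereVolume (d : ℕ) (r : ℝ) : Measure (EuclideanSpace ℝ (Fin d)) :=
  ENNReal.ofReal (r ^ (d - 1)) •
    ((volume : Measure (EuclideanSpace ℝ (Fin d))).toSphere.map
      (fun t : Metric.sphere (0 : EuclideanSpace ℝ (Fin d)) 1 =>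
        r • (t : EuclideanSpace ℝ (Fin d))))

/-- The volume `S_{n-1} = 2 π^{n/2} / Γ(n/2)` of the unit sphere of `ℝ^n`. -/
def unitSphereVolume (n : ℕ) : ℝ :=
  2 * Real.pi ^ ((n : ℝ) / 2) / Real.Gamma ((n : ℝ) / 2)

/-- The Fisher-Bingham integral `f(λ, τ, r)`. -/
def integral {d : ℕ} (lam tau : Fin d → ℝ) (r : ℝ) : ℝ :=
  ∫ t, Real.exp (∑ i, lam i * t i ^ 2 + ∑ i, tau i * t i) ∂(sphereVolume d r)

/-- The partial derivative of `f` with respect to `λ_j` at `(λ, τ, r)`. -/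
def derivLam {d : ℕ} (lam tau : Fin d → ℝ) (j : Fin d) (r : ℝ) : ℝ :=
  deriv (fun s => integral (Function.update lam j s) tau r) (lam j)

/-- The partial derivative of `f` with respect to `τ_j` at `(λ, τ, r)`. -/
def derivTau {d : ℕ} (lam tau : Fin d → ℝ) (j : Fin d) (r : ℝ) : ℝ :=
  deriv (fun s => integral lam (Function.update tau j s) r) (tau j)

end FisherBingham

end

/-!
An orthogonal change of coordinates, chosen according to whether the linear term vanishes on the
leading eigenspace, turns the exponent into `γ t_p + ∑ (-κ_i t_i² + ν_i t_i)` plus a constant on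
each sphere, the sum being over coordinates transversal to the set of maxima. Parametrise the sphere
of radius `r` by gnomonic coordinates: a direction `θ` in the span of the remaining coordinates
together with the ratios `z` of the transversal coordinates. Transversal coordinates are of size
`1` where the quadratic term is present, and of size `√r` along the directions in which only the
curvature of the sphere, seen through the linear term `γ t_p`, confines the integral. After
rescaling each coordinate by its size, dominated convergence yields a Gaussian integral times an
integral over `θ`, not only for `f` but for every moment of `t_j / size`. The derivatives of `f` are
the moments of `t_j` and `t_j²`, and comparing their limits with that of `f` gives all the
asymptotics.
-/

noncomputable section

namespace FisherBingham

open Metric Set Topology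

section Sphere

variable {E F : Type*} [NormedAddCommGroup E] [NormedSpace ℝ E] [MeasurableSpace E] [BorelSpace E]
  [NormedAddCommGroup F] [NormedSpace ℝ F] [MeasurableSpace F] [BorelSpace F]

theorem ae_toSphere_notMem_submodule [FiniteDimensional ℝ E] (μ : Measure E) [μ.IsAddHaarMeasure]
    {S : Submodule ℝ E} (hS : S ≠ ⊤) : ∀ᵐ ω : sphere (0 : E) 1 ∂μ.toSphere, (ω : E) ∉ S := by
  have hmeas : MeasurableSet {ω : sphere (0 : E) 1 | ¬ (ω : E) ∉ S} := by
    simp only [not_not]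
    exact (S.closed_of_finiteDimensional.preimage continuous_subtype_val).measurableSet
  rw [ae_iff, Measure.toSphere_apply' _ hmeas]
  refine mul_eq_zero_of_right _ (measure_mono_null ?_ (Measure.addHaar_submodule μ S hS))
  rintro _ ⟨s, -, _, ⟨ω, hω, rfl⟩, rfl⟩
  exact S.smul_mem s (not_not.1 hω)

theorem integral_toSphere_comp_linearIsometryEquiv {μ : Measure E} {ν : Measure F}
    (L : E ≃ₗᵢ[ℝ] F) (hL : MeasurePreserving L μ ν) (φ : F → ℝ) :
    ∫ ω, φ (L (ω : E)) ∂μ.toSphere = ∫ ω, φ (ω : F) ∂ν.toSphere := by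
  let e : sphere (0 : E) 1 ≃ₜ sphere (0 : F) 1 := L.toHomeomorph.subtype fun x => by simp
  have he : MeasurePreserving e μ.toSphere ν.toSphere := by
    refine ⟨e.measurable, Measure.ext fun s hs => ?_⟩
    rw [Measure.map_apply e.measurable hs, Measure.toSphere_apply' _ (e.measurable hs),
      Measure.toSphere_apply' _ hs, L.toLinearEquiv.finrank_eq,
      ← hL.measure_preimage_equiv (f := L.toHomeomorph.toMeasurableEquiv)]
    congr 2
    ext x
    constructor
    · rintro ⟨c, hc, _, ⟨ω, hω, rfl⟩, rfl⟩
      exact ⟨c, hc, _, ⟨e ω, hω, rfl⟩, (L.map_smul c _).symm⟩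
    · rintro ⟨c, hc, _, ⟨ω, hω, rfl⟩, hx⟩
      refine ⟨c, hc, _, ⟨e.symm ω, by simpa using hω, rfl⟩, L.injective ?_⟩
      simpa [e] using hx
  exact he.integral_comp e.measurableEmbedding fun ω => φ ω

variable [FiniteDimensional ℝ E]

theorem lintegral_polar [Nontrivial E] (μ : Measure E) [μ.IsAddHaarMeasure] {H : E → ENNReal}
    (hH : Measurable H) :
    ∫⁻ x, H x ∂μ = ∫⁻ ω, (∫⁻ s in Ioi (0 : ℝ),
      ENNReal.ofReal (s ^ (Module.finrank ℝ E - 1)) * H (s • (ω : E))) ∂μ.toSphere := by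
  have hmeas : Measurable fun p : sphere (0 : E) 1 × Ioi (0 : ℝ) => H ((p.2 : ℝ) • (p.1 : E)) :=
    hH.comp (by fun_prop)
  calc ∫⁻ x, H x ∂μ = ∫⁻ x : ({(0 : E)}ᶜ : Set E), H x.1 ∂(μ.comap (↑)) := by
        rw [lintegral_subtype_comap (measurableSet_singleton _).compl, restrict_compl_singleton]
    _ = ∫⁻ p, H ((p.2 : ℝ) • (p.1 : E))
          ∂μ.toSphere.prod (Measure.volumeIoiPow (Module.finrank ℝ E - 1)) := by
        rw [← μ.measurePreserving_homeomorphUnitSphereProd.lintegral_comp hmeas]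
        refine lintegral_congr fun x => ?_
        have hx : ‖(x : E)‖ ≠ 0 := norm_ne_zero_iff.2 x.2
        simp [smul_smul, hx]
    _ = ∫⁻ ω, (∫⁻ s : Ioi (0 : ℝ), ENNReal.ofReal ((s : ℝ) ^ (Module.finrank ℝ E - 1)) *
          H ((s : ℝ) • (ω : E)) ∂(volume : Measure ℝ).comap (↑)) ∂μ.toSphere := by
        rw [lintegral_prod _ hmeas.aemeasurable]
        refine lintegral_congr fun ω => ?_
        rw [Measure.volumeIoiPow, lintegral_withDensity_eq_lintegral_mul _ (by fun_prop)
          (show Measurable fun y : Ioi (0 : ℝ) => H ((y : ℝ) • (ω : E)) from hH.comp (by fun_prop))]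
        rfl
    _ = _ := lintegral_congr fun ω => lintegral_subtype_comap measurableSet_Ioi fun s =>
        ENNReal.ofReal (s ^ (Module.finrank ℝ E - 1)) * H (s • (ω : E))

end Sphere

theorem lintegral_Ioi_pow_mul_exp_neg_mul (n : ℕ) {c : ℝ} (hc : 0 < c) :
    ∫⁻ s in Ioi (0 : ℝ), ENNReal.ofReal (s ^ n * Real.exp (-(c * s))) =
      ENNReal.ofReal (n.factorial / c ^ (n + 1)) := by
  have hcongr : ∀ s : ℝ, s ^ ((n : ℝ) + 1 - 1) * Real.exp (-(c * s)) =
      s ^ n * Real.exp (-(c * s)) := fun s => by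
    rw [add_sub_cancel_right, Real.rpow_natCast]
  have hGamma := Real.integral_rpow_mul_exp_neg_mul_Ioi (a := n + 1) (by positivity) hc
  have hpos : (0 : ℝ) < n.factorial / c ^ (n + 1) := by positivity
  have hvalue : ∫ s in Ioi (0 : ℝ), s ^ n * Real.exp (-(c * s)) = n.factorial / c ^ (n + 1) := by
    simp only [hcongr] at hGamma
    rw [hGamma, Real.Gamma_nat_eq_factorial, ← Nat.cast_add_one, Real.rpow_natCast, one_div,
      inv_pow, mul_comm, div_eq_mul_inv]
  rw [← hvalue, ofReal_integral_eq_lintegral_ofReal]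
  · exact Integrable.of_integral_ne_zero (hvalue ▸ hpos.ne')
  · filter_upwards [ae_restrict_mem measurableSet_Ioi] with s hs
    have hs : 0 < s := hs
    positivity

section Pi

variable {ι : Type*} [Fintype ι]

theorem lintegral_comp_mul_pi {D : ι → ℝ} (hD : ∀ i, 0 < D i) {h : (ι → ℝ) → ENNReal}
    (hh : Measurable h) :
    ∫⁻ y, h y = ENNReal.ofReal (∏ i, D i) * ∫⁻ z : ι → ℝ, h (D * z) := by
  classical
  have hdet : (Matrix.diagonal D).det = ∏ i, D i := Matrix.det_diagonal
  have hpos : 0 < ∏ i, D i := Finset.prod_pos fun i _ => hD i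
  have hmap := Real.smul_map_diagonal_volume_pi (D := D) (hdet ▸ hpos.ne')
  have hfun : ⇑(Matrix.toLin' (Matrix.diagonal D)) = (D * ·) := by
    ext z i
    simp [Matrix.mulVec_diagonal]
  rw [hdet, abs_of_pos hpos, hfun] at hmap
  conv_lhs => rw [← hmap]
  rw [lintegral_smul_measure, lintegral_map hh (measurable_const_mul D), smul_eq_mul]

end Pi

/-- The unit sphere of the Euclidean space `ℝ^ι`. -/
abbrev UnitSphere (ι : Type*) [Fintype ι] := sphere (0 : EuclideanSpace ℝ ι) 1

/-- The surface measure of the unit sphere of `ℝ^ι`. -/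
abbrev surfaceMeasure (ι : Type*) [Fintype ι] : Measure (UnitSphere ι) :=
  (volume : Measure (EuclideanSpace ℝ ι)).toSphere

section Join

variable {ι : Type*} {P : ι → Prop}

/-- The projection of `ℝ^ι` to the coordinates in `P`. -/
def proj (P : ι → Prop) : EuclideanSpace ℝ ι →L[ℝ] EuclideanSpace ℝ {i // P i} :=
  (EuclideanSpace.equiv _ ℝ).symm.toContinuousLinearMap.comp
    (ContinuousLinearMap.pi fun i => EuclideanSpace.proj i.1)

@[simp]
theorem proj_apply (t : EuclideanSpace ℝ ι) (i : {i // P i}) : proj P t i = t i := rfl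

variable [DecidablePred P]

/-- The vector with the coordinates `x` in `P` and the coordinates `y` outside `P`. The first block
carries the Euclidean norm because its unit sphere serves as the base of gnomonic coordinates. -/
def join (x : EuclideanSpace ℝ {i // P i}) (y : {i // ¬ P i} → ℝ) : EuclideanSpace ℝ ι :=
  WithLp.toLp 2 fun i => if h : P i then x ⟨i, h⟩ else y ⟨i, h⟩

theorem join_apply_of_pos (x : EuclideanSpace ℝ {i // P i}) (y : {i // ¬ P i} → ℝ) {i : ι}
    (h : P i) : join x y i = x ⟨i, h⟩ := by
  simp [join, h]

theorem join_apply_of_neg (x : EuclideanSpace ℝ {i // P i}) (y : {i // ¬ P i} → ℝ) {i : ι}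
    (h : ¬ P i) : join x y i = y ⟨i, h⟩ := by
  simp [join, h]

theorem smul_join (s : ℝ) (x : EuclideanSpace ℝ {i // P i}) (y : {i // ¬ P i} → ℝ) :
    s • join x y = join (s • x) (s • y) := by
  ext i
  by_cases h : P i <;> simp [join, h]

@[fun_prop]
theorem continuous_join {X : Type*} [TopologicalSpace X]
    {f : X → EuclideanSpace ℝ {i // P i}} {g : X → {i // ¬ P i} → ℝ}
    (hf : Continuous f) (hg : Continuous g) : Continuous fun x => join (f x) (g x) := by
  refine (PiLp.continuous_toLp 2 _).comp (continuous_pi fun i => ?_)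
  by_cases h : P i <;> simp only [h, dite_true, dite_false] <;> fun_prop

theorem norm_sq_join [Fintype ι] (x : EuclideanSpace ℝ {i // P i}) (y : {i // ¬ P i} → ℝ) :
    ‖join x y‖ ^ 2 = ‖x‖ ^ 2 + ∑ i, y i ^ 2 := by
  rw [EuclideanSpace.real_norm_sq_eq, EuclideanSpace.real_norm_sq_eq,
    ← Fintype.sum_subtype_add_sum_subtype P]
  exact congrArg₂ _ (Finset.sum_congr rfl fun i _ => by rw [join_apply_of_pos x y i.2])
    (Finset.sum_congr rfl fun i _ => by rw [join_apply_of_neg x y i.2])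

@[simp]
theorem proj_join (x : EuclideanSpace ℝ {i // P i}) (y : {i // ¬ P i} → ℝ) :
    proj P (join x y) = x := by
  ext i
  rw [proj_apply, join_apply_of_pos _ _ i.2]

theorem lintegral_join [Fintype ι] {H : EuclideanSpace ℝ ι → ENNReal} (hH : Measurable H) :
    ∫⁻ t, H t = ∫⁻ x : EuclideanSpace ℝ {i // P i}, ∫⁻ y : {i // ¬ P i} → ℝ, H (join x y) := by
  have hι := PiLp.volume_preserving_toLp ι
  have hP := PiLp.volume_preserving_toLp {i // P i}
  have hsplit := (volume_preserving_piEquivPiSubtypeProd (fun _ : ι => ℝ) P).symm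
  have hmeas : Measurable fun p : EuclideanSpace ℝ {i // P i} × ({i // ¬ P i} → ℝ) =>
      H (join p.1 p.2) := hH.comp (by fun_prop : Continuous _).measurable
  calc ∫⁻ t, H t = ∫⁻ p : ({i // P i} → ℝ) × ({i // ¬ P i} → ℝ),
        H (join (WithLp.toLp 2 p.1) p.2) := by
        rw [← hι.lintegral_comp hH]
        exact (hsplit.lintegral_comp (hH.comp hι.measurable)).symm
    _ = ∫⁻ x : {i // P i} → ℝ, ∫⁻ y : {i // ¬ P i} → ℝ, H (join (WithLp.toLp 2 x) y) := by
        rw [Measure.volume_eq_prod, lintegral_prod]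
        exact (hmeas.comp ((WithLp.measurable_toLp 2 _).prodMap measurable_id)).aemeasurable
    _ = _ := hP.lintegral_comp (f := fun x => ∫⁻ y, H (join x y)) hmeas.lintegral_prod_right'

end Join

section Gnomonic

variable {ι : Type*} [Fintype ι] {P : ι → Prop} [DecidablePred P]

/-- Gnomonic coordinates on the sphere: the central projection of `(θ, z)` to the unit sphere of
`ℝ^ι`, as a vector. They parametrise the complement of a null set. -/
def gnomonic (θ : UnitSphere {i // P i}) (z : {i // ¬ P i} → ℝ) : EuclideanSpace ℝ ι :=
  ‖join (θ : EuclideanSpace ℝ {i // P i}) z‖⁻¹ • join (θ : EuclideanSpace ℝ {i // P i}) z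

theorem norm_sq_join_sphere (θ : UnitSphere {i // P i}) (z : {i // ¬ P i} → ℝ) :
    ‖join (θ : EuclideanSpace ℝ {i // P i}) z‖ ^ 2 = 1 + ∑ i, z i ^ 2 := by
  rw [norm_sq_join, norm_eq_of_mem_sphere, one_pow]

theorem norm_join_sphere_pos (θ : UnitSphere {i // P i}) (z : {i // ¬ P i} → ℝ) :
    0 < ‖join (θ : EuclideanSpace ℝ {i // P i}) z‖ := by
  refine (norm_nonneg _).lt_of_ne fun h => ?_
  have hsq := norm_sq_join_sphere θ z
  have : 0 ≤ ∑ i, z i ^ 2 := Finset.sum_nonneg fun i _ => sq_nonneg _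
  rw [← h] at hsq
  linarith

theorem norm_proj_gnomonic (θ : UnitSphere {i // P i}) (z : {i // ¬ P i} → ℝ) :
    ‖proj P (gnomonic θ z)‖ = ‖join (θ : EuclideanSpace ℝ {i // P i}) z‖⁻¹ := by
  rw [gnomonic, map_smul, proj_join, norm_smul, norm_eq_of_mem_sphere, mul_one, norm_inv, norm_norm]

@[fun_prop]
theorem continuous_gnomonic {X : Type*} [TopologicalSpace X] {f : X → UnitSphere {i // P i}}
    {g : X → {i // ¬ P i} → ℝ} (hf : Continuous f) (hg : Continuous g) :
    Continuous fun x => gnomonic (f x) (g x) := by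
  have hjoin : Continuous fun x => join (f x : EuclideanSpace ℝ {i // P i}) (g x) := by fun_prop
  exact (hjoin.norm.inv₀ fun x => (norm_join_sphere_pos _ _).ne').smul hjoin

theorem measurable_gnomonic_density (D : {i // ¬ P i} → ℝ) (N : ℕ) :
    Measurable fun p : UnitSphere {i // P i} × ({i // ¬ P i} → ℝ) =>
      ENNReal.ofReal (‖join (p.1 : EuclideanSpace ℝ {i // P i}) (D * p.2)‖⁻¹ ^ N) := by
  have hjoin : Continuous fun p : UnitSphere {i // P i} × ({i // ¬ P i} → ℝ) =>
      join (p.1 : EuclideanSpace ℝ {i // P i}) (D * p.2) := by fun_prop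
  exact (hjoin.norm.measurable.inv.pow_const _).ennreal_ofReal

theorem lintegral_join_smul_normalize_mul_exp {φ : EuclideanSpace ℝ ι → ENNReal}
    (hφ : Measurable φ) (θ : UnitSphere {i // P i}) {s : ℝ} (hs : 0 < s) :
    ∫⁻ y, φ (‖join (P := P) (s • θ.1) y‖⁻¹ • join (s • θ.1) y) *
        ENNReal.ofReal (Real.exp (-‖proj P (join (s • θ.1) y)‖)) =
      ENNReal.ofReal (s ^ Fintype.card {i // ¬ P i} * Real.exp (-s)) *
        ∫⁻ z, φ (gnomonic θ z) := by
  have hslice : Measurable fun y : {i // ¬ P i} → ℝ =>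
      φ (‖join (P := P) (s • θ.1) y‖⁻¹ • join (s • θ.1) y) *
        ENNReal.ofReal (Real.exp (-‖proj P (join (s • θ.1) y)‖)) := by
    have hjoin : Measurable fun y : {i // ¬ P i} → ℝ => join (P := P) (s • θ.1) y :=
      (by fun_prop : Continuous _).measurable
    exact (hφ.comp (hjoin.norm.inv.smul hjoin)).mul (by fun_prop)
  have hgnomonic : Measurable fun z => φ (gnomonic θ z) :=
    hφ.comp (by fun_prop : Continuous _).measurable
  have hscale (z : {i // ¬ P i} → ℝ) : join (s • θ.1) ((fun _ => s) * z) = s • join θ.1 z := by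
    rw [smul_join]; rfl
  rw [lintegral_comp_mul_pi (fun _ => hs) hslice]
  simp only [hscale, map_smul, proj_join, norm_smul, norm_eq_of_mem_sphere, Real.norm_eq_abs,
    abs_of_pos hs, mul_one, smul_smul, mul_inv_rev, inv_mul_cancel_right₀ hs.ne',
    gnomonic] at hgnomonic ⊢
  rw [lintegral_mul_const _ hgnomonic, Finset.prod_const, Finset.card_univ,
    ENNReal.ofReal_mul (by positivity)]
  ring

variable [Nonempty {i // P i}]

theorem ae_surfaceMeasure_norm_proj_pos :
    ∀ᵐ ω : UnitSphere ι ∂surfaceMeasure ι, 0 < ‖proj P (ω : EuclideanSpace ℝ ι)‖ := by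
  have hker : (proj P).ker ≠ ⊤ := fun h => by
    classical
    obtain ⟨i⟩ := ‹Nonempty {i // P i}›
    have hmem : EuclideanSpace.single i.1 (1 : ℝ) ∈ (proj P).ker := h ▸ trivial
    simpa using congrArg (fun v => v i) hmem
  filter_upwards [ae_toSphere_notMem_submodule volume hker] with ω hω
  exact norm_pos_iff.2 hω

theorem lintegral_normalize_mul_exp_neg_norm_proj {φ : EuclideanSpace ℝ ι → ENNReal}
    (hφ : Measurable φ) :
    ∫⁻ t, φ (‖t‖⁻¹ • t) * ENNReal.ofReal (Real.exp (-‖proj P t‖)) =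
      ∫⁻ ω, φ ω * ENNReal.ofReal ((Fintype.card ι - 1).factorial /
        ‖proj P (ω : EuclideanSpace ℝ ι)‖ ^ Fintype.card ι) ∂surfaceMeasure ι := by
  have : Nonempty ι := ⟨(Classical.arbitrary {i // P i}).1⟩
  have hH : Measurable fun t : EuclideanSpace ℝ ι =>
      φ (‖t‖⁻¹ • t) * ENNReal.ofReal (Real.exp (-‖proj P t‖)) :=
    (hφ.comp (by fun_prop)).mul (by fun_prop)
  rw [lintegral_polar volume hH, finrank_euclideanSpace]
  refine lintegral_congr_ae ?_
  filter_upwards [ae_surfaceMeasure_norm_proj_pos (P := P)] with ω hω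
  have hvalue := lintegral_Ioi_pow_mul_exp_neg_mul (Fintype.card ι - 1) hω
  rw [Nat.sub_add_cancel Fintype.card_pos] at hvalue
  rw [← hvalue, ← lintegral_const_mul _ (by fun_prop)]
  refine setLIntegral_congr_fun measurableSet_Ioi fun s (hs : 0 < s) => ?_
  simp only [map_smul, norm_smul, norm_eq_of_mem_sphere, Real.norm_eq_abs, abs_of_pos hs, mul_one,
    smul_smul, inv_mul_cancel₀ hs.ne', one_smul]
  rw [mul_left_comm, ← ENNReal.ofReal_mul (by positivity), mul_comm s]

theorem lintegral_normalize_mul_exp_neg_norm_proj_eq_gnomonic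
    {φ : EuclideanSpace ℝ ι → ENNReal} (hφ : Measurable φ) :
    ∫⁻ t, φ (‖t‖⁻¹ • t) * ENNReal.ofReal (Real.exp (-‖proj P t‖)) =
      ENNReal.ofReal (Fintype.card ι - 1).factorial *
        ∫⁻ θ, (∫⁻ z, φ (gnomonic θ z)) ∂surfaceMeasure {i // P i} := by
  have hcard : Fintype.card ι - 1 = Fintype.card {i // P i} - 1 + Fintype.card {i // ¬ P i} := by
    have h₁ := Fintype.card_subtype_compl P
    have h₂ := Fintype.card_subtype_le P
    have h₃ : 0 < Fintype.card {i // P i} := Fintype.card_pos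
    omega
  let H : EuclideanSpace ℝ ι → ENNReal :=
    fun t => φ (‖t‖⁻¹ • t) * ENNReal.ofReal (Real.exp (-‖proj P t‖))
  have hH : Measurable H := (hφ.comp (by fun_prop)).mul (by fun_prop)
  have hHjoin : Measurable fun p : EuclideanSpace ℝ {i // P i} × ({i // ¬ P i} → ℝ) =>
      H (join p.1 p.2) := hH.comp (by fun_prop : Continuous _).measurable
  change ∫⁻ t, H t = _
  rw [lintegral_join (P := P) hH, lintegral_polar volume hHjoin.lintegral_prod_right',
    ← lintegral_const_mul' _ _ ENNReal.ofReal_ne_top, finrank_euclideanSpace]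
  refine lintegral_congr fun θ => ?_
  have hray : ∀ s ∈ Ioi (0 : ℝ), ENNReal.ofReal (s ^ (Fintype.card {i // P i} - 1)) *
      ∫⁻ y, H (join (s • (θ : EuclideanSpace ℝ {i // P i})) y) =
      ENNReal.ofReal (s ^ (Fintype.card ι - 1) * Real.exp (-(1 * s))) *
        ∫⁻ z, φ (gnomonic θ z) := by
    intro s (hs : 0 < s)
    rw [lintegral_join_smul_normalize_mul_exp hφ θ hs, ← mul_assoc,
      ← ENNReal.ofReal_mul (by positivity), ← mul_assoc, ← pow_add, hcard, one_mul]
  rw [setLIntegral_congr_fun measurableSet_Ioi hray, lintegral_mul_const _ (by fun_prop),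
    lintegral_Ioi_pow_mul_exp_neg_mul _ one_pos, one_pow, div_one]

theorem lintegral_surfaceMeasure_eq_gnomonic {φ : EuclideanSpace ℝ ι → ENNReal}
    (hφ : Measurable φ) :
    ∫⁻ ω, φ ω ∂surfaceMeasure ι =
      ∫⁻ θ, (∫⁻ z, φ (gnomonic θ z) *
        ENNReal.ofReal (‖join (θ : EuclideanSpace ℝ {i // P i}) z‖⁻¹ ^ Fintype.card ι))
        ∂surfaceMeasure {i // P i} := by
  set N := Fintype.card ι
  let ψ : EuclideanSpace ℝ ι → ENNReal := fun t => φ t * ENNReal.ofReal (‖proj P t‖ ^ N)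
  have hψ : Measurable ψ := hφ.mul (by fun_prop)
  have hfact : ENNReal.ofReal (N - 1).factorial ≠ 0 := by
    simpa using Nat.factorial_ne_zero _
  have key := (lintegral_normalize_mul_exp_neg_norm_proj (P := P) hψ).symm.trans
    (lintegral_normalize_mul_exp_neg_norm_proj_eq_gnomonic hψ)
  have hcancel : ∀ᵐ ω : UnitSphere ι ∂surfaceMeasure ι,
      ψ ω * ENNReal.ofReal ((N - 1).factorial / ‖proj P (ω : EuclideanSpace ℝ ι)‖ ^ N) =
        ENNReal.ofReal (N - 1).factorial * φ ω := by
    filter_upwards [ae_surfaceMeasure_norm_proj_pos (P := P)] with ω hω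
    rw [mul_assoc, ← ENNReal.ofReal_mul (by positivity), mul_div_cancel₀ _ (by positivity),
      mul_comm]
  rw [lintegral_congr_ae hcancel, lintegral_const_mul' _ _ ENNReal.ofReal_ne_top,
    ENNReal.mul_right_inj hfact ENNReal.ofReal_ne_top] at key
  simpa only [ψ, norm_proj_gnomonic] using key

theorem map_coe_surfaceMeasure_eq_gnomonic {D : {i // ¬ P i} → ℝ} (hD : ∀ i, 0 < D i) :
    (surfaceMeasure ι).map (↑) = ENNReal.ofReal (∏ i, D i) •
      (((surfaceMeasure {i // P i}).prod volume).withDensity fun p => ENNReal.ofReal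
        (‖join (p.1 : EuclideanSpace ℝ {i // P i}) (D * p.2)‖⁻¹ ^ Fintype.card ι)).map
          fun p => gnomonic p.1 (D * p.2) := by
  have hw := measurable_gnomonic_density (P := P) D (Fintype.card ι)
  have hG : Measurable fun p : UnitSphere {i // P i} × ({i // ¬ P i} → ℝ) =>
      gnomonic p.1 (D * p.2) := (by fun_prop : Continuous _).measurable
  refine Measure.ext_of_lintegral _ fun f hf => ?_
  have hfG : Measurable fun p : UnitSphere {i // P i} × ({i // ¬ P i} → ℝ) =>
      f (gnomonic p.1 (D * p.2)) := hf.comp hG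
  have hm := hw.mul hfG
  rw [lintegral_map hf (by fun_prop), lintegral_smul_measure, lintegral_map hf hG,
    lintegral_withDensity_eq_lintegral_mul _ hw hfG,
    lintegral_surfaceMeasure_eq_gnomonic (P := P) hf, smul_eq_mul,
    lintegral_prod _ hm.aemeasurable, ← lintegral_const_mul _ hm.lintegral_prod_right']
  refine lintegral_congr fun θ => ?_
  have hz : Measurable fun z => f (gnomonic θ z) *
      ENNReal.ofReal (‖join (θ : EuclideanSpace ℝ {i // P i}) z‖⁻¹ ^ Fintype.card ι) :=
    (hf.comp (by fun_prop : Continuous _).measurable).mul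
      (((by fun_prop : Continuous fun z => join θ.1 z).norm.measurable.inv.pow_const
        _).ennreal_ofReal)
  rw [lintegral_comp_mul_pi hD hz]
  simp only [Pi.mul_apply, mul_comm]

theorem integral_surfaceMeasure_eq_gnomonic {φ : EuclideanSpace ℝ ι → ℝ} (hφ : Measurable φ)
    {D : {i // ¬ P i} → ℝ} (hD : ∀ i, 0 < D i) :
    ∫ ω, φ ω ∂surfaceMeasure ι =
      (∏ i, D i) * ∫ p : UnitSphere {i // P i} × ({i // ¬ P i} → ℝ),
        ‖join (p.1 : EuclideanSpace ℝ {i // P i}) (D * p.2)‖⁻¹ ^ Fintype.card ι *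
          φ (gnomonic p.1 (D * p.2)) ∂(surfaceMeasure {i // P i}).prod volume := by
  have hG : Measurable fun p : UnitSphere {i // P i} × ({i // ¬ P i} → ℝ) =>
      gnomonic p.1 (D * p.2) := (by fun_prop : Continuous _).measurable
  rw [← integral_map (φ := fun ω : UnitSphere ι => (ω : EuclideanSpace ℝ ι))
    (by fun_prop) hφ.aestronglyMeasurable, map_coe_surfaceMeasure_eq_gnomonic hD,
    integral_smul_measure, integral_map hG.aemeasurable hφ.aestronglyMeasurable,
    integral_withDensity_eq_integral_toReal_smul (measurable_gnomonic_density D _)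
      (.of_forall fun _ => ENNReal.ofReal_lt_top),
    ENNReal.toReal_ofReal (Finset.prod_nonneg fun i _ => (hD i).le), smul_eq_mul]
  simp only [smul_eq_mul, ENNReal.toReal_ofReal (pow_nonneg (inv_nonneg.2 (norm_nonneg _)) _)]

end Gnomonic

theorem sqrt_pow_eq_rpow {x : ℝ} (hx : 0 ≤ x) (n : ℕ) : √x ^ n = x ^ ((n : ℝ) / 2) := by
  rw [Real.sqrt_eq_rpow, ← Real.rpow_mul_natCast hx, one_div_mul_eq_div]

section SphereMoments

theorem unitSphereVolume_pos {n : ℕ} (hn : 0 < n) : 0 < unitSphereVolume n := by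
  have : 0 < Real.Gamma ((n : ℝ) / 2) := Real.Gamma_pos_of_pos (by positivity)
  unfold unitSphereVolume
  positivity

theorem unitSphereVolume_one : unitSphereVolume 1 = 2 := by
  rw [unitSphereVolume, Nat.cast_one, Real.Gamma_one_half_eq, ← Real.sqrt_eq_rpow,
    mul_div_cancel_right₀ _ (Real.sqrt_ne_zero'.2 Real.pi_pos)]

variable {ι : Type*} [Fintype ι]

theorem unitSphere_apply_le_one (θ : UnitSphere ι) (i : ι) : θ.1 i ≤ 1 :=
  (le_abs_self _).trans ((PiLp.norm_apply_le θ.1 i).trans_eq (norm_eq_of_mem_sphere θ))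

theorem surfaceMeasure_real_univ [Nonempty ι] :
    (surfaceMeasure ι).real univ = unitSphereVolume (Fintype.card ι) := by
  have hn : 0 < (Fintype.card ι : ℝ) / 2 := by have := Fintype.card_pos (α := ι); positivity
  have hΓ := (Real.Gamma_pos_of_pos hn).ne'
  rw [Measure.toSphere_real_apply_univ, finrank_euclideanSpace, measureReal_def,
    EuclideanSpace.volume_ball, unitSphereVolume, sqrt_pow_eq_rpow Real.pi_pos.le,
    Real.Gamma_add_one hn.ne', ENNReal.ofReal_one, one_pow, one_mul,
    ENNReal.toReal_ofReal (by positivity)]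
  field_simp

theorem integrable_surfaceMeasure {φ : EuclideanSpace ℝ ι → ℝ} (hφ : Continuous φ) :
    Integrable (fun ω : UnitSphere ι => φ ω) (surfaceMeasure ι) :=
  (hφ.comp continuous_subtype_val).integrable_of_hasCompactSupport
    (HasCompactSupport.of_compactSpace _)

theorem integral_surfaceMeasure_comp (L : EuclideanSpace ℝ ι ≃ₗᵢ[ℝ] EuclideanSpace ℝ ι)
    (φ : EuclideanSpace ℝ ι → ℝ) :
    ∫ ω, φ (L (ω : EuclideanSpace ℝ ι)) ∂surfaceMeasure ι =
      ∫ ω, φ (ω : EuclideanSpace ℝ ι) ∂surfaceMeasure ι :=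
  integral_toSphere_comp_linearIsometryEquiv L L.measurePreserving φ

theorem integral_surfaceMeasure_apply_sq [Nonempty ι] (j : ι) :
    ∫ ω, (ω : EuclideanSpace ℝ ι) j ^ 2 ∂surfaceMeasure ι =
      unitSphereVolume (Fintype.card ι) / Fintype.card ι := by
  classical
  have hsymm : ∀ i, ∫ ω, (ω : EuclideanSpace ℝ ι) i ^ 2 ∂surfaceMeasure ι =
      ∫ ω, (ω : EuclideanSpace ℝ ι) j ^ 2 ∂surfaceMeasure ι := fun i => by
    simpa [LinearIsometryEquiv.piLpCongrLeft_apply, Equiv.piCongrLeft'] using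
      integral_surfaceMeasure_comp (LinearIsometryEquiv.piLpCongrLeft 2 ℝ ℝ (Equiv.swap i j))
        fun t => t j ^ 2
  have hsum : ∑ i, ∫ ω, (ω : EuclideanSpace ℝ ι) i ^ 2 ∂surfaceMeasure ι =
      unitSphereVolume (Fintype.card ι) := by
    rw [← integral_finsetSum _ fun i _ =>
      integrable_surfaceMeasure (φ := fun t : EuclideanSpace ℝ ι => t i ^ 2) (by fun_prop)]
    simp only [← EuclideanSpace.real_norm_sq_eq, norm_eq_of_mem_sphere, one_pow, integral_const,
      surfaceMeasure_real_univ, smul_eq_mul, mul_one]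
  simp_rw [hsymm] at hsum
  rw [Finset.sum_const, Finset.card_univ, nsmul_eq_mul] at hsum
  rw [← hsum, mul_div_cancel_left₀ _ (Nat.cast_ne_zero.2 Fintype.card_ne_zero)]

theorem integral_surfaceMeasure_ite_of_unique [Unique ι] :
    ∫ ω, (if (ω : EuclideanSpace ℝ ι) default = 1 then (1 : ℝ) else 0) ∂surfaceMeasure ι = 1 := by
  set f : EuclideanSpace ℝ ι → ℝ := fun t => if t default = 1 then 1 else 0
  have hintegrable : ∀ c : ℝ, Integrable (fun ω : UnitSphere ι => f (c • (ω : EuclideanSpace ℝ ι)))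
      (surfaceMeasure ι) := fun c => by
    refine Integrable.of_bound ?_ 1 (.of_forall fun ω => by simp only [f]; split_ifs <;> simp)
    have hm : Measurable f := Measurable.ite
      ((measurableSet_singleton (1 : ℝ)).preimage (by fun_prop)) measurable_const measurable_const
    exact (hm.comp (by fun_prop)).aestronglyMeasurable
  have hneg : ∫ ω, f (-(ω : EuclideanSpace ℝ ι)) ∂surfaceMeasure ι = ∫ ω, f ω ∂surfaceMeasure ι :=
    integral_surfaceMeasure_comp (LinearIsometryEquiv.neg ℝ) f
  have hone : ∀ ω : UnitSphere ι, f ω + f (-(ω : EuclideanSpace ℝ ι)) = 1 := fun ω => by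
    have hsq := EuclideanSpace.real_norm_sq_eq (ω : EuclideanSpace ℝ ι)
    rw [norm_eq_of_mem_sphere, Fintype.sum_unique, one_pow, eq_comm, sq_eq_one_iff] at hsq
    rcases hsq with h | h <;> norm_num [f, h]
  have hsum : ∫ ω, f ω ∂surfaceMeasure ι + ∫ ω, f (-(ω : EuclideanSpace ℝ ι)) ∂surfaceMeasure ι
      = 2 := by
    rw [← integral_add (by simpa using hintegrable 1) (by simpa using hintegrable (-1))]
    simp only [hone, integral_const, surfaceMeasure_real_univ, Fintype.card_unique,
      unitSphereVolume_one, smul_eq_mul, mul_one]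
  linarith

end SphereMoments

section Gaussian

open ProbabilityTheory

theorem integral_mul_exp_quadratic {κ : ℝ} (hκ : 0 < κ) (ν : ℝ) (h : ℝ → ℝ) :
    ∫ x, h x * Real.exp (-κ * x ^ 2 + ν * x) =
      (∫ x, h x ∂gaussianReal (ν / (2 * κ)) (1 / (2 * κ)).toNNReal) *
        (√(Real.pi / κ) * Real.exp (ν ^ 2 / (4 * κ))) := by
  have hv : 0 < 1 / (2 * κ) := by positivity
  have hpdf : ∀ x, gaussianPDFReal (ν / (2 * κ)) (1 / (2 * κ)).toNNReal x *
      (√(Real.pi / κ) * Real.exp (ν ^ 2 / (4 * κ))) =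
        Real.exp (-κ * x ^ 2 + ν * x) := fun x => by
    have hroot : √(Real.pi / κ) ≠ 0 := by positivity
    rw [gaussianPDFReal_def, Real.coe_toNNReal _ hv.le,
      show 2 * Real.pi * (1 / (2 * κ)) = Real.pi / κ by field_simp, mul_mul_mul_comm,
      inv_mul_cancel₀ hroot, one_mul, ← Real.exp_add]
    congr 1
    field_simp
    ring
  rw [integral_gaussianReal_eq_integral_smul (by simpa using hκ), ← integral_mul_const]
  refine integral_congr_ae (.of_forall fun x => ?_)
  simp only [smul_eq_mul, ← hpdf x]
  ring

theorem integral_sq_gaussianReal (μ : ℝ) (v : NNReal) :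
    ∫ x, x ^ 2 ∂gaussianReal μ v = v + μ ^ 2 := by
  have hvar := variance_eq_sub (memLp_id_gaussianReal (μ := μ) (v := v) 2)
  rw [variance_id_gaussianReal] at hvar
  simp only [Pi.pow_apply, id, integral_id_gaussianReal] at hvar
  linarith

variable {ι : Type*} [Fintype ι]

/-- The total mass of the Gaussian density `exp (∑ (-κ_i a_i² + ν_i a_i))`. -/
def gaussMass (κ ν : ι → ℝ) : ℝ :=
  ∏ i, (√(Real.pi / κ i) * Real.exp (ν i ^ 2 / (4 * κ i)))

variable {κ : ι → ℝ} (hκ : ∀ i, 0 < κ i) (ν : ι → ℝ)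

include hκ

theorem gaussMass_pos : 0 < gaussMass κ ν :=
  Finset.prod_pos fun i _ => by have := hκ i; positivity

theorem integral_exp_sum_quadratic :
    ∫ a : ι → ℝ, Real.exp (∑ i, (-κ i * a i ^ 2 + ν i * a i)) = gaussMass κ ν := by
  simp_rw [Real.exp_sum]
  rw [integral_fintype_prod_volume_eq_prod fun i x => Real.exp (-κ i * x ^ 2 + ν i * x)]
  refine Finset.prod_congr rfl fun i _ => ?_
  simpa using integral_mul_exp_quadratic (hκ i) (ν i) fun _ => 1

theorem integral_comp_eval_mul_exp_sum_quadratic (j : ι) (h : ℝ → ℝ) :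
    ∫ a : ι → ℝ, h (a j) * Real.exp (∑ i, (-κ i * a i ^ 2 + ν i * a i)) =
      (∫ x, h x ∂gaussianReal (ν j / (2 * κ j)) (1 / (2 * κ j)).toNNReal) * gaussMass κ ν := by
  classical
  have hprod : ∀ a : ι → ℝ, h (a j) * Real.exp (∑ i, (-κ i * a i ^ 2 + ν i * a i)) =
      ∏ i, (if i = j then h (a i) else 1) * Real.exp (-κ i * a i ^ 2 + ν i * a i) := fun a => by
    rw [Finset.prod_mul_distrib, Real.exp_sum, Finset.prod_ite_eq' Finset.univ j,
      if_pos (Finset.mem_univ j)]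
  simp_rw [hprod]
  rw [integral_fintype_prod_volume_eq_prod fun i x =>
    (if i = j then h x else 1) * Real.exp (-κ i * x ^ 2 + ν i * x), gaussMass]
  simp_rw [fun i => integral_mul_exp_quadratic (hκ i) (ν i) fun x => if i = j then h x else 1]
  rw [Finset.prod_mul_distrib, Finset.prod_eq_single j (fun i _ hi => by simp [hi]) (by simp)]
  simp only [if_true]

theorem integral_eval_mul_exp_sum_quadratic (j : ι) :
    ∫ a : ι → ℝ, a j * Real.exp (∑ i, (-κ i * a i ^ 2 + ν i * a i)) =
      ν j / (2 * κ j) * gaussMass κ ν := by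
  rw [integral_comp_eval_mul_exp_sum_quadratic hκ ν j fun x => x, integral_id_gaussianReal]

theorem integral_eval_sq_mul_exp_sum_quadratic (j : ι) :
    ∫ a : ι → ℝ, a j ^ 2 * Real.exp (∑ i, (-κ i * a i ^ 2 + ν i * a i)) =
      (1 / (2 * κ j) + ν j ^ 2 / (4 * κ j ^ 2)) * gaussMass κ ν := by
  have hj := hκ j
  rw [integral_comp_eval_mul_exp_sum_quadratic hκ ν j fun x => x ^ 2, integral_sq_gaussianReal,
    Real.coe_toNNReal _ (by positivity), div_pow]
  ring

end Gaussian

section Bounds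

theorem one_add_pow_mul_exp_neg_le {c v : ℝ} (hc : 0 < c) (hv : 0 ≤ v) (n : ℕ) :
    (1 + v) ^ n * Real.exp (-(c * v)) ≤ n.factorial * Real.exp c / c ^ n := by
  have h := Real.pow_div_factorial_le_exp (x := c * (1 + v)) (by positivity) n
  rw [div_le_iff₀ (by positivity), mul_pow, mul_add, mul_one, Real.exp_add] at h
  rw [le_div_iff₀ (by positivity), Real.exp_neg, mul_right_comm, ← div_eq_mul_inv,
    div_le_iff₀ (Real.exp_pos _)]
  linarith

theorem inv_pow_mul_inv_one_add_pow_le_rpow {ρ v s : ℝ} (hρ : 0 < ρ) (hv : 0 ≤ v) (hs : 0 ≤ s)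
    (h : 1 + s ≤ ρ ^ 2 * (1 + v)) (n : ℕ) :
    ρ⁻¹ ^ n * ((1 + v) ^ n)⁻¹ ≤ (1 + s) ^ (-(n : ℝ) / 2) := by
  have hroot : √(1 + s) ≤ ρ * (1 + v) := by
    refine Real.sqrt_le_iff.2 ⟨by positivity, h.trans ?_⟩
    rw [mul_pow]
    exact mul_le_mul_of_nonneg_left (le_self_pow₀ (by linarith) two_ne_zero) (sq_nonneg ρ)
  have hpow : (1 + s) ^ (-(n : ℝ) / 2) = (√(1 + s) ^ n)⁻¹ := by
    rw [sqrt_pow_eq_rpow (by positivity), ← Real.rpow_neg (by positivity), neg_div]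
  rw [hpow, inv_pow, ← mul_inv, ← mul_pow]
  have : 0 < √(1 + s) := by positivity
  gcongr

theorem inv_sub_one_le {ρ : ℝ} (hρ : 0 < ρ) : ρ⁻¹ - 1 ≤ -(1 / 2) * ((ρ ^ 2 - 1) / ρ ^ 2) := by
  have h : -(1 / 2) * ((ρ ^ 2 - 1) / ρ ^ 2) - (ρ⁻¹ - 1) = (ρ⁻¹ - 1) ^ 2 / 2 := by
    field_simp
    ring
  have := sq_nonneg (ρ⁻¹ - 1)
  linarith

theorem exists_pos_forall_le {ι : Type*} [Finite ι] {κ : ι → ℝ} (hκ : ∀ i, 0 < κ i) :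
    ∃ c > 0, ∀ i, c ≤ κ i := by
  cases isEmpty_or_nonempty ι
  · exact ⟨1, one_pos, fun i => isEmptyElim i⟩
  · obtain ⟨i, hi⟩ := Finite.exists_min κ
    exact ⟨κ i, hκ i, hi⟩

theorem exists_sum_quadratic_le {ι : Type*} [Fintype ι] {κ : ι → ℝ} (hκ : ∀ i, 0 < κ i)
    (ν : ι → ℝ) : ∃ c > 0, ∃ T, ∀ b : ι → ℝ,
      ∑ i, (-κ i * b i ^ 2 + ν i * b i) ≤ -(c * ∑ i, b i ^ 2) + T := by
  obtain ⟨c, hc, hcκ⟩ := exists_pos_forall_le hκ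
  refine ⟨c / 2, half_pos hc, ∑ i, ν i ^ 2 / (2 * c), fun b => ?_⟩
  rw [Finset.mul_sum, ← Finset.sum_neg_distrib, ← Finset.sum_add_distrib]
  refine Finset.sum_le_sum fun i _ => ?_
  have hcurv : c * b i ^ 2 ≤ κ i * b i ^ 2 := mul_le_mul_of_nonneg_right (hcκ i) (sq_nonneg _)
  have hsq : ν i ^ 2 / (2 * c) - ν i * b i + c / 2 * b i ^ 2 = (ν i - c * b i) ^ 2 / (2 * c) := by
    field_simp
    ring
  have : 0 ≤ (ν i - c * b i) ^ 2 / (2 * c) := by positivity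
  linarith

end Bounds

/-- The data of a Fisher-Bingham exponent to which Laplace's method applies in the gnomonic
coordinates over the coordinates `P`: a linear term of slope `γ` in the direction `pole`, and a
concave quadratic term `-κ t² + ν t` in each coordinate outside `P`. The `tangential` coordinates
do not enter the exponent; they owe their Gaussian behaviour, on the scale `√r`, to the curvature
of the sphere at the pole, and `κ = γ / 2`, `ν = 0` describe the limit. -/
structure Phase {ι : Type*} (P : ι → Prop) where
  pole : {i // P i}
  γ : ℝ
  κ : {i // ¬ P i} → ℝ
  ν : {i // ¬ P i} → ℝ
  tangential : {i // ¬ P i} → Prop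
  [decidableTangential : DecidablePred tangential]
  γ_nonneg : 0 ≤ γ
  κ_pos : ∀ i, 0 < κ i
  κ_of_tangential : ∀ i, tangential i → κ i = γ / 2
  ν_of_tangential : ∀ i, tangential i → ν i = 0

namespace Phase

attribute [instance] Phase.decidableTangential

variable {ι : Type*} {P : ι → Prop} (Φ : Phase P)

section Scale

/-- The size of the coordinate `i` under the density on the sphere of radius `r`. -/
def scale (r : ℝ) (i : {i // ¬ P i}) : ℝ := if Φ.tangential i then √r else 1

/-- The size of the coordinate `i` in gnomonic coordinates. -/
def dilation (r : ℝ) (i : {i // ¬ P i}) : ℝ := Φ.scale r i / r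

variable {r : ℝ} (i : {i // ¬ P i})

variable {Φ i} in
theorem scale_of_tangential (hi : Φ.tangential i) : Φ.scale r i = √r := if_pos hi

variable {Φ i} in
theorem scale_of_not_tangential (hi : ¬ Φ.tangential i) : Φ.scale r i = 1 := if_neg hi

theorem scale_pos (hr : 0 < r) : 0 < Φ.scale r i := by
  unfold scale
  split_ifs <;> positivity

theorem dilation_pos (hr : 0 < r) : 0 < Φ.dilation r i := div_pos (Φ.scale_pos i hr) hr

theorem tendsto_dilation : Tendsto (fun r => Φ.dilation r i) atTop (𝓝 0) := by
  by_cases hi : Φ.tangential i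
  · simp_rw [dilation, scale_of_tangential hi, Real.sqrt_div_self]
    exact tendsto_inv_atTop_zero.comp Real.tendsto_sqrt_atTop
  · simp_rw [dilation, scale_of_not_tangential hi]
    exact tendsto_const_nhds.div_atTop tendsto_id

theorem mul_dilation_sq_of_tangential (hr : 0 < r) (hi : Φ.tangential i) :
    r * Φ.dilation r i ^ 2 = 1 := by
  rw [dilation, scale_of_tangential hi, div_pow, Real.sq_sqrt hr.le]
  field_simp

theorem tendsto_mul_dilation_sq :
    Tendsto (fun r => r * Φ.dilation r i ^ 2) atTop (𝓝 (if Φ.tangential i then 1 else 0)) := by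
  split_ifs with hi
  · refine tendsto_const_nhds.congr' ?_
    filter_upwards [eventually_gt_atTop 0] with r hr
    rw [Φ.mul_dilation_sq_of_tangential i hr hi]
  · refine tendsto_inv_atTop_zero.congr' ?_
    filter_upwards [eventually_gt_atTop 0] with r hr
    rw [dilation, scale_of_not_tangential hi]
    field_simp

end Scale

variable [Fintype ι] [DecidablePred P]

section Chart

variable (r : ℝ) (θ : UnitSphere {i // P i}) (a : {i // ¬ P i} → ℝ)

/-- The length of the vector whose normalisation is the point with gnomonic coordinates `θ` and
`Φ.dilation r * a`. -/
def chartNorm : ℝ := ‖join (θ : EuclideanSpace ℝ {i // P i}) (Φ.dilation r * a)‖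

/-- The point of the sphere of radius `r` with rescaled gnomonic coordinates `(θ, a)`. -/
def chart : EuclideanSpace ℝ ι := r • gnomonic θ (Φ.dilation r * a)

theorem chartNorm_pos : 0 < Φ.chartNorm r θ a := norm_join_sphere_pos θ _

theorem chartNorm_sq : Φ.chartNorm r θ a ^ 2 = 1 + ∑ i, Φ.dilation r i ^ 2 * a i ^ 2 := by
  simp only [chartNorm, norm_sq_join_sphere, Pi.mul_apply, mul_pow]

theorem one_le_chartNorm_sq : 1 ≤ Φ.chartNorm r θ a ^ 2 := by
  rw [chartNorm_sq]
  exact le_add_of_nonneg_right (Finset.sum_nonneg fun _ _ => by positivity)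

theorem chart_apply_of_pos (i : {i // P i}) :
    Φ.chart r θ a i = r * (θ.1 i / Φ.chartNorm r θ a) := by
  simp only [chart, gnomonic, chartNorm, PiLp.smul_apply, smul_eq_mul, join_apply_of_pos _ _ i.2]
  ring

variable {r} in
theorem chart_apply_of_neg (hr : r ≠ 0) (i : {i // ¬ P i}) :
    Φ.chart r θ a i = Φ.scale r i * (a i / Φ.chartNorm r θ a) := by
  simp only [chart, gnomonic, chartNorm, PiLp.smul_apply, smul_eq_mul, join_apply_of_neg _ _ i.2,
    Pi.mul_apply, dilation]
  field_simp

variable {r} in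
theorem norm_chart (hr : 0 ≤ r) : ‖Φ.chart r θ a‖ = r := by
  rw [chart, gnomonic, norm_smul, norm_smul, norm_inv, norm_norm,
    inv_mul_cancel₀ (norm_join_sphere_pos _ _).ne', mul_one, Real.norm_of_nonneg hr]

theorem continuous_chartNorm :
    Continuous fun p : UnitSphere {i // P i} × ({i // ¬ P i} → ℝ) => Φ.chartNorm r p.1 p.2 := by
  unfold chartNorm
  fun_prop

theorem continuous_chart :
    Continuous fun p : UnitSphere {i // P i} × ({i // ¬ P i} → ℝ) => Φ.chart r p.1 p.2 := by
  unfold chart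
  fun_prop

theorem one_add_norm_sq_le :
    1 + ‖a‖ ^ 2 ≤ Φ.chartNorm r θ a ^ 2 * (1 + ∑ i, (a i / Φ.chartNorm r θ a) ^ 2) := by
  have hρ := Φ.chartNorm_pos r θ a
  have hnorm : ‖a‖ ^ 2 ≤ ∑ i, a i ^ 2 := by
    have hsup : ‖a‖ ≤ ‖WithLp.toLp 2 a‖ :=
      (pi_norm_le_iff_of_nonneg (norm_nonneg _)).2 fun i => PiLp.norm_apply_le (WithLp.toLp 2 a) i
    rw [← EuclideanSpace.real_norm_sq_eq (WithLp.toLp 2 a)]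
    gcongr
  have hsum : Φ.chartNorm r θ a ^ 2 * ∑ i, (a i / Φ.chartNorm r θ a) ^ 2 = ∑ i, a i ^ 2 := by
    rw [Finset.mul_sum]
    exact Finset.sum_congr rfl fun i _ => by field_simp
  rw [mul_add, hsum, mul_one]
  exact add_le_add (Φ.one_le_chartNorm_sq r θ a) hnorm

theorem tendsto_chartNorm : Tendsto (fun r => Φ.chartNorm r θ a) atTop (𝓝 1) := by
  have hsq : Tendsto (fun r => 1 + ∑ i, Φ.dilation r i ^ 2 * a i ^ 2) atTop
      (𝓝 (1 + ∑ i : {i // ¬ P i}, 0 ^ 2 * a i ^ 2)) :=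
    tendsto_const_nhds.add (tendsto_finsetSum _ fun i _ =>
      ((Φ.tendsto_dilation i).pow 2).mul_const _)
  simpa [← Φ.chartNorm_sq _ θ a, Real.sqrt_sq (Φ.chartNorm_pos _ θ a).le] using hsq.sqrt

theorem tendsto_div_chartNorm (x : ℝ) :
    Tendsto (fun r => x / Φ.chartNorm r θ a) atTop (𝓝 x) := by
  have h : Tendsto (fun r => x / Φ.chartNorm r θ a) atTop (𝓝 (x / 1)) :=
    tendsto_const_nhds.div (Φ.tendsto_chartNorm θ a) one_ne_zero
  rwa [div_one] at h

theorem tendsto_mul_inv_chartNorm_sub_one :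
    Tendsto (fun r => r * ((Φ.chartNorm r θ a)⁻¹ - 1)) atTop
      (𝓝 (-(1 / 2) * ∑ i, if Φ.tangential i then a i ^ 2 else 0)) := by
  have hsum : Tendsto (fun r => ∑ i, r * Φ.dilation r i ^ 2 * a i ^ 2) atTop
      (𝓝 (∑ i, (if Φ.tangential i then 1 else 0) * a i ^ 2)) :=
    tendsto_finsetSum _ fun i _ => (Φ.tendsto_mul_dilation_sq i).mul_const _
  have hfactor : Tendsto (fun r => -(Φ.chartNorm r θ a * (Φ.chartNorm r θ a + 1))⁻¹) atTop
      (𝓝 (-((1 : ℝ) * (1 + 1))⁻¹)) :=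
    (((Φ.tendsto_chartNorm θ a).mul ((Φ.tendsto_chartNorm θ a).add_const 1)).inv₀
      (by norm_num)).neg
  have hrewrite : ∀ r, -(Φ.chartNorm r θ a * (Φ.chartNorm r θ a + 1))⁻¹ *
      ∑ i, r * Φ.dilation r i ^ 2 * a i ^ 2 = r * ((Φ.chartNorm r θ a)⁻¹ - 1) := fun r => by
    have hρ := Φ.chartNorm_pos r θ a
    have hsq : ∑ i, r * Φ.dilation r i ^ 2 * a i ^ 2 = r * (Φ.chartNorm r θ a ^ 2 - 1) := by
      simp only [chartNorm_sq, add_sub_cancel_left, Finset.mul_sum, mul_assoc]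
    rw [hsq]
    field_simp
    ring
  convert (hfactor.mul hsum).congr hrewrite using 2
  norm_num

theorem tendsto_chart_apply_div_scale (j : {i // ¬ P i}) :
    Tendsto (fun r => Φ.chart r θ a j / Φ.scale r j) atTop (𝓝 (a j)) := by
  refine (Φ.tendsto_div_chartNorm θ a (a j)).congr' ?_
  filter_upwards [eventually_gt_atTop 0] with r hr
  rw [Φ.chart_apply_of_neg θ a hr.ne', mul_div_cancel_left₀ _ (Φ.scale_pos j hr).ne']

theorem tendsto_inv_smul_chart :
    Tendsto (fun r => r⁻¹ • Φ.chart r θ a) atTop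
      (𝓝 (join (θ : EuclideanSpace ℝ {i // P i}) 0)) := by
  have hdil : Tendsto (fun r => Φ.dilation r * a) atTop (𝓝 0) :=
    tendsto_pi_nhds.2 fun i => by simpa using (Φ.tendsto_dilation i).mul_const (a i)
  have hcont : Continuous (gnomonic θ) := by fun_prop
  have hzero : gnomonic θ 0 = join (θ : EuclideanSpace ℝ {i // P i}) 0 := by
    have hnorm : ‖join (θ : EuclideanSpace ℝ {i // P i}) 0‖ = 1 := by
      rw [← sq_eq_sq₀ (norm_nonneg _) zero_le_one, norm_sq_join_sphere]
      simp
    rw [gnomonic, hnorm, inv_one, one_smul]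
  refine hzero ▸ ((hcont.tendsto 0).comp hdil).congr' ?_
  filter_upwards [eventually_gt_atTop 0] with r hr
  rw [chart, inv_smul_smul₀ hr.ne', Function.comp_apply]

end Chart

end Phase

theorem integrable_one_add_norm_sq_rpow {ι : Type*} [Fintype ι] {P : ι → Prop} [DecidablePred P]
    [Nonempty {i // P i}] (B : ℝ) :
    Integrable (fun p : UnitSphere {i // P i} × ({i // ¬ P i} → ℝ) =>
      B * (1 + ‖p.2‖ ^ 2) ^ (-(Fintype.card ι : ℝ) / 2))
      ((surfaceMeasure {i // P i}).prod volume) := by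
  obtain ⟨i, hi⟩ := ‹Nonempty {i // P i}›
  have hlt : (Module.finrank ℝ ({i // ¬ P i} → ℝ) : ℝ) < Fintype.card ι := by
    rw [Module.finrank_fintype_fun_eq_card]
    exact_mod_cast Fintype.card_subtype_lt (x := i) (not_not.2 hi)
  exact ((integrable_rpow_neg_one_add_norm_sq hlt).comp_snd _).const_mul B

namespace Phase

variable {ι : Type*} {P : ι → Prop} (Φ : Phase P) [Fintype ι] [DecidablePred P]

section Eval

/-- The part of the exponent that depends on the coordinates outside `P`. -/
def transversal (b : {i // ¬ P i} → ℝ) : ℝ :=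
  ∑ i, if Φ.tangential i then 0 else (-Φ.κ i * b i ^ 2 + Φ.ν i * b i)

/-- The exponent described by `Φ`. -/
def eval (t : EuclideanSpace ℝ ι) : ℝ := Φ.γ * t Φ.pole + Φ.transversal fun i => t i

/-- The limit of the exponent in rescaled gnomonic coordinates, at the pole. -/
def quadratic (b : {i // ¬ P i} → ℝ) : ℝ := ∑ i, (-Φ.κ i * b i ^ 2 + Φ.ν i * b i)

theorem continuous_transversal : Continuous Φ.transversal :=
  continuous_finsetSum _ fun i _ => by split_ifs <;> fun_prop

theorem continuous_eval : Continuous Φ.eval :=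
  (by fun_prop : Continuous fun t : EuclideanSpace ℝ ι => Φ.γ * t Φ.pole).add
    (Φ.continuous_transversal.comp (by fun_prop))

theorem curvature_add_transversal (b : {i // ¬ P i} → ℝ) :
    Φ.γ * (-(1 / 2) * ∑ i, if Φ.tangential i then b i ^ 2 else 0) + Φ.transversal b =
      Φ.quadratic b := by
  rw [transversal, Finset.mul_sum, Finset.mul_sum, ← Finset.sum_add_distrib]
  refine Finset.sum_congr rfl fun i _ => ?_
  split_ifs with hi
  · rw [Φ.κ_of_tangential i hi, Φ.ν_of_tangential i hi]
    ring
  · ring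

theorem transversal_eq_quadratic (hγ : Φ.γ = 0) (b : {i // ¬ P i} → ℝ) :
    Φ.transversal b = Φ.quadratic b := by
  rw [← Φ.curvature_add_transversal, hγ, zero_mul, zero_add]

variable {r : ℝ} (θ : UnitSphere {i // P i}) (a : {i // ¬ P i} → ℝ)

theorem eval_chart_sub (hr : r ≠ 0) :
    Φ.eval (Φ.chart r θ a) - Φ.γ * r =
      Φ.γ * (r * (θ.1 Φ.pole / Φ.chartNorm r θ a - 1)) +
        Φ.transversal fun i => a i / Φ.chartNorm r θ a := by
  have htrans : (Φ.transversal fun i => Φ.chart r θ a i) =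
      Φ.transversal fun i => a i / Φ.chartNorm r θ a :=
    Finset.sum_congr rfl fun i _ => by
      split_ifs with hi
      · rfl
      · simp only [Φ.chart_apply_of_neg θ a hr, scale_of_not_tangential hi, one_mul]
  rw [eval, htrans, chart_apply_of_pos]
  ring

theorem mul_div_chartNorm_sub_one_le (hr : 0 < r) :
    r * (θ.1 Φ.pole / Φ.chartNorm r θ a - 1) ≤
      -(1 / 2) * ∑ i, if Φ.tangential i then (a i / Φ.chartNorm r θ a) ^ 2 else 0 := by
  have hρ := Φ.chartNorm_pos r θ a
  set ρ := Φ.chartNorm r θ a with hρ_def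
  have hpole : θ.1 Φ.pole / ρ ≤ ρ⁻¹ := by
    rw [← one_div]
    exact div_le_div_of_nonneg_right (unitSphere_apply_le_one θ _) hρ.le
  have hsum : r * ((ρ ^ 2 - 1) / ρ ^ 2) = ∑ i, r * Φ.dilation r i ^ 2 * (a i / ρ) ^ 2 := by
    rw [← mul_div_assoc, hρ_def, chartNorm_sq, add_sub_cancel_left, ← chartNorm_sq,
      Finset.mul_sum, Finset.sum_div]
    exact Finset.sum_congr rfl fun i _ => by rw [div_pow, mul_assoc, mul_div_assoc, mul_div_assoc]
  have htangential : (∑ i, if Φ.tangential i then (a i / ρ) ^ 2 else 0) ≤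
      ∑ i, r * Φ.dilation r i ^ 2 * (a i / ρ) ^ 2 := by
    refine Finset.sum_le_sum fun i _ => ?_
    split_ifs with hi
    · rw [Φ.mul_dilation_sq_of_tangential i hr hi, one_mul]
    · positivity
  calc r * (θ.1 Φ.pole / ρ - 1) ≤ r * (-(1 / 2) * ((ρ ^ 2 - 1) / ρ ^ 2)) :=
        mul_le_mul_of_nonneg_left ((sub_le_sub_right hpole 1).trans (inv_sub_one_le hρ)) hr.le
    _ = -(1 / 2) * (r * ((ρ ^ 2 - 1) / ρ ^ 2)) := by ring
    _ ≤ _ := by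
      rw [hsum]
      exact mul_le_mul_of_nonpos_left htangential (by norm_num)

theorem eval_chart_sub_le (hr : 0 < r) :
    Φ.eval (Φ.chart r θ a) - Φ.γ * r ≤ Φ.quadratic fun i => a i / Φ.chartNorm r θ a := by
  rw [Φ.eval_chart_sub θ a hr.ne', ← Φ.curvature_add_transversal]
  exact add_le_add_left
    (mul_le_mul_of_nonneg_left (Φ.mul_div_chartNorm_sub_one_le θ a hr) Φ.γ_nonneg) _

/-- The angular factor of the limiting density, which is concentrated at the pole unless
`γ = 0`. -/
def angularWeight (θ : EuclideanSpace ℝ {i // P i}) : ℝ :=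
  if Φ.γ = 0 ∨ θ Φ.pole = 1 then 1 else 0

theorem tendsto_exp_eval_chart_sub :
    Tendsto (fun r => Real.exp (Φ.eval (Φ.chart r θ a) - Φ.γ * r)) atTop
      (𝓝 (Φ.angularWeight θ * Real.exp (Φ.quadratic a))) := by
  have hrewrite : ∀ᶠ r in atTop, Real.exp (Φ.γ * (r * (θ.1 Φ.pole / Φ.chartNorm r θ a - 1)) +
      Φ.transversal fun i => a i / Φ.chartNorm r θ a) =
      Real.exp (Φ.eval (Φ.chart r θ a) - Φ.γ * r) := by
    filter_upwards [eventually_ne_atTop 0] with r hr using by rw [Φ.eval_chart_sub θ a hr]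
  refine Tendsto.congr' hrewrite ?_
  have htrans : Tendsto (fun r => Φ.transversal fun i => a i / Φ.chartNorm r θ a) atTop
      (𝓝 (Φ.transversal a)) :=
    (Φ.continuous_transversal.tendsto a).comp
      (tendsto_pi_nhds.2 fun i => Φ.tendsto_div_chartNorm θ a (a i))
  unfold angularWeight
  split_ifs with h
  · obtain hγ | hpole := h
    · simpa only [hγ, zero_mul, zero_add, one_mul, Φ.transversal_eq_quadratic hγ] using htrans.rexp
    · simp only [hpole, one_div, one_mul, ← Φ.curvature_add_transversal]
      simpa only [one_div] using
        (((Φ.tendsto_mul_inv_chartNorm_sub_one θ a).const_mul Φ.γ).add htrans).rexp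
  · obtain ⟨hγ, hpole⟩ := not_or.1 h
    have hlt : θ.1 Φ.pole - 1 < 0 := sub_neg.2 ((unitSphere_apply_le_one θ _).lt_of_ne hpole)
    rw [zero_mul]
    exact Real.tendsto_exp_atBot.comp ((Tendsto.const_mul_atBot (Φ.γ_nonneg.lt_of_ne' hγ)
      (tendsto_id.atTop_mul_neg hlt ((Φ.tendsto_div_chartNorm θ a _).sub_const 1))).atBot_add
        htrans)

end Eval

section Laplace

/-- A polynomial weight in the rescaled coordinates, dominating the functions whose moments are
taken. -/
def weight (r : ℝ) (t : EuclideanSpace ℝ ι) : ℝ :=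
  1 + ∑ i : {i // ¬ P i}, (t i / Φ.scale r i) ^ 2

/-- The integrand of `g * exp (eval - γ r)` over the sphere of radius `r`, in rescaled gnomonic
coordinates. -/
def kernel (g : EuclideanSpace ℝ ι → ℝ) (r : ℝ)
    (p : UnitSphere {i // P i} × ({i // ¬ P i} → ℝ)) : ℝ :=
  (Φ.chartNorm r p.1 p.2)⁻¹ ^ Fintype.card ι *
    (g (Φ.chart r p.1 p.2) * Real.exp (Φ.eval (Φ.chart r p.1 p.2) - Φ.γ * r))

variable {r : ℝ} {g : EuclideanSpace ℝ ι → ℝ}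

theorem continuous_kernel (hg : Continuous g) : Continuous (Φ.kernel g r) := by
  have hchart := Φ.continuous_chart r
  have heval := Φ.continuous_eval
  refine (((Φ.continuous_chartNorm r).inv₀ fun p => (Φ.chartNorm_pos r _ _).ne').pow _).mul ?_
  fun_prop

theorem integral_mul_exp_eval_smul (hg : Continuous g) (hr : 0 < r) :
    (∏ i, Φ.dilation r i)⁻¹ * Real.exp (-(Φ.γ * r)) *
        ∫ ω, g (r • (ω : EuclideanSpace ℝ ι)) * Real.exp (Φ.eval (r • (ω : EuclideanSpace ℝ ι)))
          ∂surfaceMeasure ι =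
      ∫ p, Φ.kernel g r p ∂(surfaceMeasure {i // P i}).prod volume := by
  have : Nonempty {i // P i} := ⟨Φ.pole⟩
  have hdil : ∏ i, Φ.dilation r i ≠ 0 :=
    (Finset.prod_pos fun i _ => Φ.dilation_pos i hr).ne'
  have heval := Φ.continuous_eval
  have hcont : Continuous fun t : EuclideanSpace ℝ ι =>
      g (r • t) * Real.exp (Φ.eval (r • t)) := by fun_prop
  rw [integral_surfaceMeasure_eq_gnomonic hcont.measurable fun i => Φ.dilation_pos i hr,
    mul_mul_mul_comm, inv_mul_cancel₀ hdil, one_mul, ← integral_const_mul]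
  refine integral_congr_ae (.of_forall fun p => ?_)
  simp only [kernel, chartNorm, chart, sub_eq_add_neg, Real.exp_add]
  ring

theorem weight_chart (hr : 0 < r) (θ : UnitSphere {i // P i}) (a : {i // ¬ P i} → ℝ) :
    Φ.weight r (Φ.chart r θ a) = 1 + ∑ i, (a i / Φ.chartNorm r θ a) ^ 2 := by
  simp only [weight, Φ.chart_apply_of_neg θ a hr.ne',
    mul_div_cancel_left₀ _ (Φ.scale_pos _ hr).ne']

theorem exists_norm_kernel_le (C : ℝ) :
    ∃ B : ℝ, ∀ ⦃g : EuclideanSpace ℝ ι → ℝ⦄ ⦃r : ℝ⦄, 0 < r →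
      (∀ t, ‖t‖ = r → |g t| ≤ C * Φ.weight r t) →
        ∀ p, ‖Φ.kernel g r p‖ ≤ B * (1 + ‖p.2‖ ^ 2) ^ (-(Fintype.card ι : ℝ) / 2) := by
  obtain ⟨c, hc, T, hT⟩ := exists_sum_quadratic_le Φ.κ_pos Φ.ν
  set N := Fintype.card ι
  set A := (N + 1).factorial * Real.exp c / c ^ (N + 1)
  refine ⟨|C| * (A * Real.exp T), fun g r hr hg p => ?_⟩
  have hρ := Φ.chartNorm_pos r p.1 p.2
  set ρ := Φ.chartNorm r p.1 p.2
  set v := ∑ i, (p.2 i / ρ) ^ 2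
  have hv : 0 ≤ v := Finset.sum_nonneg fun _ _ => sq_nonneg _
  have hg' : |g (Φ.chart r p.1 p.2)| ≤ |C| * (1 + v) := by
    refine (hg _ (Φ.norm_chart p.1 p.2 hr.le)).trans ?_
    rw [Φ.weight_chart hr]
    exact mul_le_mul_of_nonneg_right (le_abs_self C) (add_nonneg zero_le_one hv)
  have hexp : Real.exp (Φ.eval (Φ.chart r p.1 p.2) - Φ.γ * r) ≤
      Real.exp (-(c * v)) * Real.exp T := by
    rw [← Real.exp_add]
    exact Real.exp_le_exp.2 ((Φ.eval_chart_sub_le p.1 p.2 hr).trans (hT _))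
  have hgauss := one_add_pow_mul_exp_neg_le hc hv (N + 1)
  have hdecay := inv_pow_mul_inv_one_add_pow_le_rpow hρ hv (sq_nonneg ‖p.2‖)
    (Φ.one_add_norm_sq_le r p.1 p.2) N
  calc ‖Φ.kernel g r p‖ = ρ⁻¹ ^ N * (|g (Φ.chart r p.1 p.2)| *
        Real.exp (Φ.eval (Φ.chart r p.1 p.2) - Φ.γ * r)) := by
        rw [kernel, norm_mul, norm_mul, Real.norm_eq_abs (g _), Real.norm_of_nonneg (by positivity),
          Real.norm_of_nonneg (Real.exp_pos _).le]
    _ ≤ ρ⁻¹ ^ N * (|C| * (1 + v) * (Real.exp (-(c * v)) * Real.exp T)) := by gcongr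
    _ = |C| * ((1 + v) ^ (N + 1) * Real.exp (-(c * v)) * Real.exp T) *
        (ρ⁻¹ ^ N * ((1 + v) ^ N)⁻¹) := by
      have : (1 + v) ^ N ≠ 0 := by positivity
      rw [pow_succ]
      field_simp
    _ ≤ |C| * (A * Real.exp T) * (1 + ‖p.2‖ ^ 2) ^ (-(N : ℝ) / 2) := by gcongr

theorem tendsto_integral_mul_exp_eval {g : ℝ → EuclideanSpace ℝ ι → ℝ}
    (hg : ∀ r, Continuous (g r)) {C : ℝ}
    (hgC : ∀ r, 1 ≤ r → ∀ t, ‖t‖ = r → |g r t| ≤ C * Φ.weight r t)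
    {gθ : EuclideanSpace ℝ {i // P i} → ℝ} {ga : ({i // ¬ P i} → ℝ) → ℝ}
    (hlim : ∀ (θ : UnitSphere {i // P i}) (a : {i // ¬ P i} → ℝ),
      Tendsto (fun r => g r (Φ.chart r θ a)) atTop (𝓝 (gθ θ * ga a))) :
    Tendsto (fun r => (∏ i, Φ.dilation r i)⁻¹ * Real.exp (-(Φ.γ * r)) *
        ∫ ω, g r (r • (ω : EuclideanSpace ℝ ι)) *
          Real.exp (Φ.eval (r • (ω : EuclideanSpace ℝ ι))) ∂surfaceMeasure ι) atTop
      (𝓝 ((∫ θ, Φ.angularWeight θ * gθ θ ∂surfaceMeasure {i // P i}) *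
        ∫ a, ga a * Real.exp (Φ.quadratic a))) := by
  have : Nonempty {i // P i} := ⟨Φ.pole⟩
  obtain ⟨B, hB⟩ := Φ.exists_norm_kernel_le C
  rw [← integral_prod_mul (fun θ : UnitSphere {i // P i} => Φ.angularWeight θ * gθ θ)
    (fun a => ga a * Real.exp (Φ.quadratic a))]
  have hdominated := tendsto_integral_filter_of_dominated_convergence
    (μ := (surfaceMeasure {i // P i}).prod volume) (F := fun r => Φ.kernel (g r) r) (l := atTop)
    (f := fun p => Φ.angularWeight p.1 * gθ p.1 * (ga p.2 * Real.exp (Φ.quadratic p.2))) _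
    (.of_forall fun r => (Φ.continuous_kernel (hg r)).aestronglyMeasurable)
    ((eventually_ge_atTop 1).mono fun r hr =>
      .of_forall (hB (one_pos.trans_le hr) (hgC r hr)))
    (integrable_one_add_norm_sq_rpow B) (.of_forall fun p => ?_)
  · refine hdominated.congr' ?_
    filter_upwards [eventually_gt_atTop 0] with r hr
    exact (Φ.integral_mul_exp_eval_smul (hg r) hr).symm
  · have hnorm := ((Φ.tendsto_chartNorm p.1 p.2).inv₀ one_ne_zero).pow (Fintype.card ι)
    rw [inv_one, one_pow] at hnorm
    convert hnorm.mul ((hlim p.1 p.2).mul (Φ.tendsto_exp_eval_chart_sub p.1 p.2)) using 2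
    · rfl
    · ring

end Laplace

end Phase

section Moments

theorem hasDerivAt_integral_exp_add_mul {X : Type*} [TopologicalSpace X] [CompactSpace X]
    [MeasurableSpace X] [OpensMeasurableSpace X] (μ : Measure X) [IsFiniteMeasure μ] {h k : X → ℝ}
    (hh : Continuous h) (hk : Continuous k) (s₀ : ℝ) :
    HasDerivAt (fun s => ∫ x, Real.exp (h x + s * k x) ∂μ)
      (∫ x, k x * Real.exp (h x + s₀ * k x) ∂μ) s₀ := by
  obtain ⟨B, hB⟩ := ((isCompact_closedBall s₀ 1).prod isCompact_univ).exists_bound_of_continuousOn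
    (f := fun p : ℝ × X => k p.2 * Real.exp (h p.2 + p.1 * k p.2)) (by fun_prop)
  have hintegrable : Integrable (fun x => Real.exp (h x + s₀ * k x)) μ :=
    (by fun_prop : Continuous _).integrable_of_hasCompactSupport
      (HasCompactSupport.of_compactSpace _)
  refine (hasDerivAt_integral_of_dominated_loc_of_deriv_le (closedBall_mem_nhds s₀ one_pos)
    (.of_forall fun s => (by fun_prop : Continuous _).aestronglyMeasurable) hintegrable
    (by fun_prop : Continuous _).aestronglyMeasurable
    (.of_forall fun x s hs => hB (s, x) ⟨hs, mem_univ x⟩) (integrable_const B)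
    (.of_forall fun x s _ => ?_)).2
  have hlinear : HasDerivAt (fun s => h x + s * k x) (k x) s := by
    simpa only [id, one_mul] using ((hasDerivAt_id s).mul_const (k x)).const_add (h x)
  rw [mul_comm]
  exact hlinear.exp

theorem sum_update_mul {ι : Type*} [Fintype ι] [DecidableEq ι] (v u : ι → ℝ) (j : ι) (s : ℝ) :
    ∑ i, Function.update v j s i * u i = ∑ i, v i * u i - v j * u j + s * u j := by
  rw [← Finset.add_sum_erase _ (fun i => v i * u i) (Finset.mem_univ j),
    ← Finset.add_sum_erase _ _ (Finset.mem_univ j), Function.update_self,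
    Finset.sum_congr rfl fun i hi => by rw [Function.update_of_ne (Finset.ne_of_mem_erase hi)]]
  ring

variable {d : ℕ} {r : ℝ}

theorem integral_sphereVolume (hr : 0 < r) {F : EuclideanSpace ℝ (Fin d) → ℝ}
    (hF : Continuous F) :
    ∫ t, F t ∂sphereVolume d r =
      r ^ (d - 1) * ∫ ω, F (r • (ω : EuclideanSpace ℝ (Fin d))) ∂surfaceMeasure (Fin d) := by
  rw [sphereVolume, integral_smul_measure, ENNReal.toReal_ofReal (by positivity), smul_eq_mul,
    integral_map (by fun_prop) hF.aestronglyMeasurable]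

theorem integral_sphereVolume_comp (hr : 0 < r)
    (L : EuclideanSpace ℝ (Fin d) ≃ₗᵢ[ℝ] EuclideanSpace ℝ (Fin d))
    {F : EuclideanSpace ℝ (Fin d) → ℝ} (hF : Continuous F) :
    ∫ t, F (L t) ∂sphereVolume d r = ∫ t, F t ∂sphereVolume d r := by
  rw [integral_sphereVolume hr (F := fun t => F (L t)) (hF.comp L.continuous),
    integral_sphereVolume hr hF]
  simp only [map_smul]
  rw [integral_surfaceMeasure_comp L fun t => F (r • t)]

theorem hasDerivAt_integral_sphereVolume (hr : 0 < r) {h k : EuclideanSpace ℝ (Fin d) → ℝ}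
    (hh : Continuous h) (hk : Continuous k) (s₀ : ℝ) :
    HasDerivAt (fun s => ∫ t, Real.exp (h t + s * k t) ∂sphereVolume d r)
      (∫ t, k t * Real.exp (h t + s₀ * k t) ∂sphereVolume d r) s₀ := by
  have hcurve : (fun s => ∫ t, Real.exp (h t + s * k t) ∂sphereVolume d r) = fun s => _ :=
    funext fun s => integral_sphereVolume hr (by fun_prop)
  rw [hcurve, integral_sphereVolume hr (by fun_prop)]
  exact (hasDerivAt_integral_exp_add_mul _ (by fun_prop) (by fun_prop) s₀).const_mul _

variable (lam tau : Fin d → ℝ)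

/-- The exponent of the Fisher-Bingham density. -/
def exponent (t : EuclideanSpace ℝ (Fin d)) : ℝ := ∑ i, lam i * t i ^ 2 + ∑ i, tau i * t i

/-- The integral of `g` against the Fisher-Bingham density on the sphere of radius `r`; the
derivatives of `integral` in the parameters are moments of `t j` and `t j ^ 2`. -/
def moment (g : EuclideanSpace ℝ (Fin d) → ℝ) (r : ℝ) : ℝ :=
  ∫ t, g t * Real.exp (exponent lam tau t) ∂sphereVolume d r

@[fun_prop]
theorem continuous_exponent : Continuous (exponent lam tau) := by
  unfold exponent
  fun_prop

theorem moment_one : moment lam tau (fun _ => 1) = integral lam tau := by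
  simp only [moment, one_mul, exponent, integral, funext_iff, implies_true]

theorem moment_const_mul (g : EuclideanSpace ℝ (Fin d) → ℝ) (c r : ℝ) :
    moment lam tau (fun t => c * g t) r = c * moment lam tau g r := by
  simp only [moment, mul_assoc]
  exact integral_const_mul _ _

variable (j : Fin d)

theorem hasDerivAt_integral_lam (hr : 0 < r) :
    HasDerivAt (fun s => integral (Function.update lam j s) tau r)
      (moment lam tau (fun t => t j ^ 2) r) (lam j) := by
  have h := hasDerivAt_integral_sphereVolume hr
    (h := fun t => exponent lam tau t - lam j * t j ^ 2) (k := fun t => t j ^ 2)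
    (by fun_prop) (by fun_prop) (lam j)
  simp only [sub_add_cancel] at h
  refine h.congr_of_eventuallyEq (.of_forall fun s => integral_congr_ae (.of_forall fun t => ?_))
  simp only [exponent, sum_update_mul lam (fun i => t i ^ 2)]
  ring_nf

theorem hasDerivAt_integral_tau (hr : 0 < r) :
    HasDerivAt (fun s => integral lam (Function.update tau j s) r)
      (moment lam tau (fun t => t j) r) (tau j) := by
  have h := hasDerivAt_integral_sphereVolume hr
    (h := fun t => exponent lam tau t - tau j * t j) (k := fun t => t j)
    (by fun_prop) (by fun_prop) (tau j)
  simp only [sub_add_cancel] at h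
  refine h.congr_of_eventuallyEq (.of_forall fun s => integral_congr_ae (.of_forall fun t => ?_))
  simp only [exponent, sum_update_mul tau (fun i => t i)]
  ring_nf

theorem derivLam_eq_moment (hr : 0 < r) :
    derivLam lam tau j r = moment lam tau (fun t => t j ^ 2) r :=
  (hasDerivAt_integral_lam lam tau j hr).deriv

theorem derivTau_eq_moment (hr : 0 < r) :
    derivTau lam tau j r = moment lam tau (fun t => t j) r :=
  (hasDerivAt_integral_tau lam tau j hr).deriv

variable {lam tau j} in
-- The density is invariant under the change of sign of `t j`.
theorem derivTau_eq_zero (hj : tau j = 0) (hr : 0 < r) : derivTau lam tau j r = 0 := by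
  let R : EuclideanSpace ℝ (Fin d) ≃ₗᵢ[ℝ] EuclideanSpace ℝ (Fin d) :=
    LinearIsometryEquiv.piLpCongrRight 2 fun i =>
      if i = j then LinearIsometryEquiv.neg ℝ else LinearIsometryEquiv.refl ℝ ℝ
  have hRj : ∀ t, R t j = -t j := fun t => by simp [R]
  have hRi : ∀ t i, i ≠ j → R t i = t i := fun t i hi => by simp [R, hi]
  have hexponent : ∀ t, exponent lam tau (R t) = exponent lam tau t := fun t => by
    unfold exponent
    congr 1 <;> refine Finset.sum_congr rfl fun i _ => ?_ <;> obtain rfl | hi := eq_or_ne i j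
    · rw [hRj, neg_sq]
    · rw [hRi t i hi]
    · rw [hj, zero_mul, zero_mul]
    · rw [hRi t i hi]
  have hodd := integral_sphereVolume_comp hr R
    (F := fun t => t j * Real.exp (exponent lam tau t)) (by fun_prop)
  simp only [hexponent, hRj, neg_mul, integral_neg] at hodd
  rw [derivTau_eq_moment lam tau j hr, moment]
  linarith

end Moments

section Equivalence

theorem isEquivalent_of_tendsto_div {α : Type*} {l : Filter α} {f h w : α → ℝ} {c : ℝ}
    (hc : c ≠ 0) (hf : Tendsto (fun x => f x / w x) l (𝓝 c))
    (hh : Tendsto (fun x => h x / w x) l (𝓝 c)) (hw : ∀ᶠ x in l, w x ≠ 0) : f ~[l] h := by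
  have hquot := ((isEquivalent_const_iff_tendsto hc).2 hf).trans
    ((isEquivalent_const_iff_tendsto hc).2 hh).symm
  refine ((hquot.mul (.refl (u := w))).congr_left ?_).congr_right ?_ <;>
    filter_upwards [hw] with x hx using div_mul_cancel₀ _ hx

end Equivalence

/-- An orthogonal change of coordinates bringing the exponent to the form of a `Phase`, up to a
term that is constant on spheres. -/
structure NormalForm {d : ℕ} (lam tau : Fin d → ℝ) (P : Fin d → Prop) [DecidablePred P] extends
    Phase P where
  Λ : ℝ
  rotation : EuclideanSpace ℝ (Fin d) ≃ₗᵢ[ℝ] EuclideanSpace ℝ (Fin d)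
  exponent_rotation : ∀ x, exponent lam tau (rotation x) = Λ * ‖x‖ ^ 2 + toPhase.eval x

namespace NormalForm

variable {d : ℕ} {lam tau : Fin d → ℝ} {P : Fin d → Prop} [DecidablePred P]
  (N : NormalForm lam tau P)

/-- The order of growth of the moments of bounded functions. -/
def growth (r : ℝ) : ℝ :=
  r ^ (d - 1) * (∏ i, N.dilation r i) * Real.exp (N.γ * r + N.Λ * r ^ 2)

theorem growth_pos {r : ℝ} (hr : 0 < r) : 0 < N.growth r :=
  mul_pos (mul_pos (pow_pos hr _) (Finset.prod_pos fun i _ => N.dilation_pos i hr))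
    (Real.exp_pos _)

theorem eventually_growth_ne_zero : ∀ᶠ r in atTop, N.growth r ≠ 0 :=
  (eventually_gt_atTop 0).mono fun _ hr => (N.growth_pos hr).ne'

/-- The limiting mass of the angular variable. -/
def angularMass : ℝ := ∫ θ, N.angularWeight θ ∂surfaceMeasure {i // P i}

theorem moment_div_growth {g : EuclideanSpace ℝ (Fin d) → ℝ} (hg : Continuous g) {r : ℝ}
    (hr : 0 < r) :
    moment lam tau g r / N.growth r = (∏ i, N.dilation r i)⁻¹ * Real.exp (-(N.γ * r)) *
      ∫ ω, g (N.rotation (r • (ω : EuclideanSpace ℝ (Fin d)))) *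
        Real.exp (N.eval (r • (ω : EuclideanSpace ℝ (Fin d)))) ∂surfaceMeasure (Fin d) := by
  have hrotate : moment lam tau g r = r ^ (d - 1) * (Real.exp (N.Λ * r ^ 2) *
      ∫ ω, g (N.rotation (r • (ω : EuclideanSpace ℝ (Fin d)))) *
        Real.exp (N.eval (r • (ω : EuclideanSpace ℝ (Fin d)))) ∂surfaceMeasure (Fin d)) := by
    rw [moment, ← integral_sphereVolume_comp hr N.rotation (by fun_prop),
      integral_sphereVolume hr
        (F := fun t => g (N.rotation t) * Real.exp (exponent lam tau (N.rotation t)))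
        (by fun_prop)]
    congr 1
    rw [← integral_const_mul]
    refine integral_congr_ae (.of_forall fun ω => ?_)
    simp only
    rw [N.exponent_rotation, norm_smul, norm_eq_of_mem_sphere, mul_one, Real.norm_of_nonneg hr.le,
      Real.exp_add]
    ring
  have hprod : ∏ i, N.dilation r i ≠ 0 :=
    Finset.prod_ne_zero_iff.2 fun i _ => (N.dilation_pos i hr).ne'
  rw [hrotate, growth, Real.exp_add, Real.exp_neg]
  field_simp

theorem tendsto_moment_div_growth {g : ℝ → EuclideanSpace ℝ (Fin d) → ℝ}
    (hg : ∀ r, Continuous (g r)) {C : ℝ}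
    (hgC : ∀ r, 1 ≤ r → ∀ x, ‖x‖ = r → |g r (N.rotation x)| ≤ C * N.weight r x)
    {gθ : EuclideanSpace ℝ {i // P i} → ℝ} {ga : ({i // ¬ P i} → ℝ) → ℝ}
    (hlim : ∀ (θ : UnitSphere {i // P i}) (a : {i // ¬ P i} → ℝ),
      Tendsto (fun r => g r (N.rotation (N.chart r θ a))) atTop (𝓝 (gθ θ * ga a))) :
    Tendsto (fun r => moment lam tau (g r) r / N.growth r) atTop
      (𝓝 ((∫ θ, N.angularWeight θ * gθ θ ∂surfaceMeasure {i // P i}) *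
        ∫ a, ga a * Real.exp (N.quadratic a))) := by
  refine (N.tendsto_integral_mul_exp_eval (g := fun r x => g r (N.rotation x))
    (fun r => (hg r).comp N.rotation.continuous) hgC hlim).congr' ?_
  filter_upwards [eventually_gt_atTop 0] with r hr using (N.moment_div_growth (hg r) hr).symm

theorem one_le_weight (r : ℝ) (x : EuclideanSpace ℝ (Fin d)) : 1 ≤ N.weight r x :=
  le_add_of_nonneg_right (Finset.sum_nonneg fun _ _ => sq_nonneg _)

theorem one_add_sq_le_weight (r : ℝ) (x : EuclideanSpace ℝ (Fin d)) (j : {i // ¬ P i}) :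
    1 + (x j / N.scale r j) ^ 2 ≤ N.weight r x :=
  add_le_add_right (Finset.single_le_sum
    (f := fun i : {i // ¬ P i} => (x i / N.scale r i) ^ 2) (fun _ _ => sq_nonneg _)
    (Finset.mem_univ j)) _

theorem tendsto_moment_pow_div_growth (j : Fin d) (n : ℕ) :
    Tendsto (fun r => moment lam tau (fun t => (t j / r) ^ n) r / N.growth r) atTop
      (𝓝 ((∫ θ, N.angularWeight θ * N.rotation (join (θ : EuclideanSpace ℝ {i // P i}) 0) j ^ n
        ∂surfaceMeasure {i // P i}) * gaussMass N.κ N.ν)) := by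
  rw [← integral_exp_sum_quadratic N.κ_pos]
  simpa only [one_mul, Phase.quadratic] using N.tendsto_moment_div_growth
    (g := fun r t => (t j / r) ^ n) (C := 1)
    (gθ := fun θ => N.rotation (join θ 0) j ^ n) (ga := fun _ => 1) (fun _ => by fun_prop)
    (fun r hr x hx => by
      have hcoord : |N.rotation x j / r| ≤ 1 := by
        rw [abs_div, abs_of_pos (one_pos.trans_le hr), div_le_one (one_pos.trans_le hr), ← hx,
          ← N.rotation.norm_map x]
        exact PiLp.norm_apply_le (N.rotation x) j
      rw [abs_pow, one_mul]
      exact (pow_le_one₀ (abs_nonneg _) hcoord).trans (N.one_le_weight r x))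
    (fun θ a => by
      have hcont : Continuous fun x => N.rotation x j := by fun_prop
      simpa [Function.comp_def, inv_mul_eq_div] using
        ((hcont.tendsto _).comp (N.tendsto_inv_smul_chart θ a)).pow n)

theorem tendsto_integral_div_growth :
    Tendsto (fun r => integral lam tau r / N.growth r) atTop
      (𝓝 (N.angularMass * gaussMass N.κ N.ν)) := by
  have h := N.tendsto_moment_div_growth (g := fun _ _ => 1) (C := 1) (gθ := fun _ => 1)
    (ga := fun _ => 1) (fun _ => continuous_const)
    (fun r _ x _ => by simpa only [abs_one, one_mul] using N.one_le_weight r x)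
    (fun _ _ => by simpa only [mul_one] using tendsto_const_nhds)
  simpa only [moment_one, mul_one, one_mul, angularMass, Phase.quadratic,
    integral_exp_sum_quadratic N.κ_pos] using h

section FixedCoordinate

variable {N} {j : {i // ¬ P i}} (hj : ∀ x, N.rotation x j = x j)
include hj

theorem tendsto_moment_coord_div_growth :
    Tendsto (fun r => moment lam tau (fun t => t j / N.scale r j) r / N.growth r) atTop
      (𝓝 (N.ν j / (2 * N.κ j) * (N.angularMass * gaussMass N.κ N.ν))) := by
  rw [mul_left_comm, ← integral_eval_mul_exp_sum_quadratic N.κ_pos]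
  simpa only [mul_one, Phase.quadratic, angularMass] using N.tendsto_moment_div_growth
    (g := fun r t => t j / N.scale r j) (C := 1) (gθ := fun _ => 1)
    (ga := fun a => a j) (fun _ => by fun_prop)
    (fun r _ x _ => by
      have hweight := N.one_add_sq_le_weight r x j
      rw [← sq_abs] at hweight
      rw [hj]
      nlinarith [sq_nonneg (|x j / N.scale r j| - 1)])
    (fun θ a => by simpa only [hj, one_mul] using N.tendsto_chart_apply_div_scale θ a j)

theorem tendsto_moment_coord_sq_div_growth :
    Tendsto (fun r => moment lam tau (fun t => (t j / N.scale r j) ^ 2) r / N.growth r) atTop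
      (𝓝 ((1 / (2 * N.κ j) + N.ν j ^ 2 / (4 * N.κ j ^ 2)) *
        (N.angularMass * gaussMass N.κ N.ν))) := by
  rw [mul_left_comm, ← integral_eval_sq_mul_exp_sum_quadratic N.κ_pos]
  simpa only [mul_one, Phase.quadratic, angularMass] using N.tendsto_moment_div_growth
    (g := fun r t => (t j / N.scale r j) ^ 2) (C := 1) (gθ := fun _ => 1) (ga := fun a => a j ^ 2)
    (fun _ => by fun_prop)
    (fun r _ x _ => by
      rw [hj, one_mul, abs_of_nonneg (sq_nonneg _)]
      exact (le_add_of_nonneg_left zero_le_one).trans (N.one_add_sq_le_weight r x j))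
    (fun θ a => by simpa only [hj, one_mul] using (N.tendsto_chart_apply_div_scale θ a j).pow 2)

end FixedCoordinate

section Equivalence

variable {N} (hmass : N.angularMass ≠ 0)
include hmass

theorem limit_ne_zero : N.angularMass * gaussMass N.κ N.ν ≠ 0 :=
  mul_ne_zero hmass (gaussMass_pos N.κ_pos N.ν).ne'

theorem isEquivalent_integral :
    integral lam tau ~[atTop] fun r => N.angularMass * gaussMass N.κ N.ν * N.growth r :=
  isEquivalent_of_tendsto_div (limit_ne_zero hmass) N.tendsto_integral_div_growth
    (tendsto_const_nhds.congr' (N.eventually_growth_ne_zero.mono fun _ h =>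
      (mul_div_cancel_right₀ _ h).symm)) N.eventually_growth_ne_zero

theorem isEquivalent_moment {g : ℝ → EuclideanSpace ℝ (Fin d) → ℝ} {c : ℝ} (hc : c ≠ 0)
    (hg : Tendsto (fun r => moment lam tau (g r) r / N.growth r) atTop
      (𝓝 (c * (N.angularMass * gaussMass N.κ N.ν)))) :
    (fun r => moment lam tau (g r) r) ~[atTop] fun r => c * integral lam tau r :=
  isEquivalent_of_tendsto_div (mul_ne_zero hc (limit_ne_zero hmass)) hg
    (by simpa only [mul_div_assoc] using N.tendsto_integral_div_growth.const_mul c)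
    N.eventually_growth_ne_zero

variable {j : Fin d} {s : ℝ → ℝ} (hs : ∀ r, 0 < r → s r ≠ 0) {c : ℝ} (hc : c ≠ 0)
include hs hc

theorem isEquivalent_derivTau
    (h : Tendsto (fun r => moment lam tau (fun t => t j / s r) r / N.growth r) atTop
      (𝓝 (c * (N.angularMass * gaussMass N.κ N.ν)))) :
    derivTau lam tau j ~[atTop] fun r => s r * c * integral lam tau r := by
  have hscaled := (IsEquivalent.refl (u := s)).mul (isEquivalent_moment hmass hc h)
  refine (hscaled.congr_left ?_).congr_right (.of_forall fun r => (mul_assoc (s r) c _).symm)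
  filter_upwards [eventually_gt_atTop 0] with r hr
  rw [Pi.mul_apply, derivTau_eq_moment lam tau j hr, ← moment_const_mul]
  simp only [mul_div_cancel₀ _ (hs r hr)]

theorem isEquivalent_derivLam
    (h : Tendsto (fun r => moment lam tau (fun t => (t j / s r) ^ 2) r / N.growth r) atTop
      (𝓝 (c * (N.angularMass * gaussMass N.κ N.ν)))) :
    derivLam lam tau j ~[atTop] fun r => s r ^ 2 * c * integral lam tau r := by
  have hscaled := (IsEquivalent.refl (u := fun r => s r ^ 2)).mul (isEquivalent_moment hmass hc h)
  refine (hscaled.congr_left ?_).congr_right (.of_forall fun r => (mul_assoc (s r ^ 2) c _).symm)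
  filter_upwards [eventually_gt_atTop 0] with r hr
  rw [Pi.mul_apply, derivLam_eq_moment lam tau j hr, ← moment_const_mul]
  simp only [← mul_pow, mul_div_cancel₀ _ (hs r hr)]

end Equivalence

end NormalForm

section FinsetLemmas

variable {ι M : Type*} [Fintype ι] [CommMonoid M] {P : ι → Prop} [DecidablePred P]

@[to_additive]
theorem prod_univ_subtype (F : ι → M) : ∏ i : {i // P i}, F i = ∏ i with P i, F i :=
  (Finset.prod_subtype _ (by simp) F).symm

@[to_additive]
theorem prod_subtype_ne_ite [DecidableEq ι] {p : ι} (hp : P p) (c : M) (F : ι → M) :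
    ∏ i : {i // ¬ i = p}, (if P i then c else F i) =
      c ^ (Fintype.card {i // P i} - 1) * ∏ i with ¬ P i, F i := by
  rw [← Finset.prod_subtype (Finset.univ.erase p) (by simp) fun i => if P i then c else F i,
    Finset.prod_ite, Finset.prod_const, Finset.filter_erase, Finset.filter_erase,
    Finset.card_erase_of_mem (by simpa using hp), Fintype.card_subtype,
    Finset.erase_eq_of_notMem (s := {i | ¬ P i}) (by simpa using hp)]

end FinsetLemmas

theorem card_not_subtype {d m : ℕ} {P : Fin d → Prop} [DecidablePred P]
    (hP : Fintype.card {i // P i} = m) : ((Finset.univ.filter (¬ P ·)).card : ℝ) = d - m := by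
  have h := Fintype.card_subtype_compl P
  have h' := Fintype.card_subtype_le P
  rw [Fintype.card_subtype, hP, Fintype.card_fin] at h
  rw [hP, Fintype.card_fin] at h'
  rw [h, Nat.cast_sub h']

section Spectrum

variable {d m : ℕ} {P : Fin d → Prop} [DecidablePred P] {lam tau : Fin d → ℝ} {lam₁ : ℝ}

theorem exponent_eq_of_forall_eq (heq : ∀ i, P i → lam i = lam₁) (x : EuclideanSpace ℝ (Fin d)) :
    exponent lam tau x = lam₁ * ‖x‖ ^ 2 + (∑ i with P i, tau i * x i +
      ∑ i with ¬ P i, (-(lam₁ - lam i) * x i ^ 2 + tau i * x i)) := by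
  have hzero : ∑ i with P i, (lam i - lam₁) * x i ^ 2 = 0 :=
    Finset.sum_eq_zero fun i hi => by rw [heq i (Finset.mem_filter.1 hi).2, sub_self, zero_mul]
  have hlam : ∑ i, (lam i - lam₁) * x i ^ 2 = ∑ i with ¬ P i, (-(lam₁ - lam i) * x i ^ 2) := by
    rw [← Finset.sum_filter_add_sum_filter_not _ P, hzero, zero_add]
    simp only [neg_sub]
  rw [Finset.sum_add_distrib, ← hlam, exponent, EuclideanSpace.real_norm_sq_eq, Finset.mul_sum,
    ← Finset.sum_filter_add_sum_filter_not _ P fun i => tau i * x i]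
  simp only [sub_mul, Finset.sum_sub_distrib]
  ring

/-- The Gaussian integral over the coordinates outside `P`. -/
def transversalMass (P : Fin d → Prop) [DecidablePred P] (lam tau : Fin d → ℝ) (lam₁ : ℝ) : ℝ :=
  ∏ i with ¬ P i, (√(Real.pi / (lam₁ - lam i)) * Real.exp (tau i ^ 2 / (4 * (lam₁ - lam i))))

theorem transversalMass_eq (hP : Fintype.card {i // P i} = m) :
    transversalMass P lam tau lam₁ =
      Real.exp (-∑ i with ¬ P i, tau i ^ 2 / (4 * (lam i - lam₁))) *
        (Real.pi ^ (((d : ℝ) - m) / 2) / ∏ i with ¬ P i, √(lam₁ - lam i)) := by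
  simp_rw [transversalMass, Real.sqrt_div Real.pi_pos.le]
  rw [Finset.prod_mul_distrib, Finset.prod_div_distrib, Finset.prod_const, ← Real.exp_sum,
    sqrt_pow_eq_rpow Real.pi_pos.le, card_not_subtype hP, mul_comm, ← Finset.sum_neg_distrib]
  simp only [← div_neg, ← mul_neg, neg_sub]

section Centred

variable (p : {i // P i}) (heq : ∀ i, P i → lam i = lam₁) (hlt : ∀ i, ¬ P i → lam i < lam₁)
  (hτ : ∀ i, P i → tau i = 0)

/-- The normal form when the linear term vanishes on the leading eigenspace: all of its unit sphere
contributes, and no rotation is needed. -/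
def centredForm : NormalForm lam tau P where
  pole := p
  γ := 0
  κ i := lam₁ - lam i
  ν i := tau i
  tangential _ := False
  γ_nonneg := le_rfl
  κ_pos i := sub_pos.2 (hlt i i.2)
  κ_of_tangential _ := False.elim
  ν_of_tangential _ := False.elim
  Λ := lam₁
  rotation := .refl ℝ _
  exponent_rotation x := by
    have hzero : ∑ i with P i, tau i * x i = 0 :=
      Finset.sum_eq_zero fun i hi => by rw [hτ i (Finset.mem_filter.1 hi).2, zero_mul]
    rw [LinearIsometryEquiv.coe_refl, id, exponent_eq_of_forall_eq heq, hzero, Phase.eval, zero_mul]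
    simp only [Phase.transversal, if_false]
    rw [← sum_univ_subtype]

theorem gaussMass_centredForm :
    gaussMass (centredForm p heq hlt hτ).κ (centredForm p heq hlt hτ).ν =
      transversalMass P lam tau lam₁ :=
  prod_univ_subtype (P := (¬ P ·)) fun i =>
    √(Real.pi / (lam₁ - lam i)) * Real.exp (tau i ^ 2 / (4 * (lam₁ - lam i)))

theorem angularMass_centredForm (hP : Fintype.card {i // P i} = m) :
    (centredForm p heq hlt hτ).angularMass = unitSphereVolume m := by
  have : Nonempty {i // P i} := ⟨p⟩
  have hweight : ∀ θ, (centredForm p heq hlt hτ).angularWeight θ = 1 := fun θ =>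
    if_pos (.inl rfl)
  simp only [NormalForm.angularMass, hweight, integral_const, surfaceMeasure_real_univ, hP,
    smul_eq_mul, mul_one]

theorem growth_centredForm (hP : Fintype.card {i // P i} = m) {r : ℝ} (hr : 0 < r) :
    (centredForm p heq hlt hτ).growth r = r ^ (m - 1) * Real.exp (r ^ 2 * lam₁) := by
  have hm : 0 < m := hP ▸ Fintype.card_pos_iff.2 ⟨p⟩
  have hmd : m ≤ d := by simpa only [hP, Fintype.card_fin] using Fintype.card_subtype_le P
  have hdil : ∏ i, (centredForm p heq hlt hτ).dilation r i = (r ^ (d - m))⁻¹ := by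
    simp [Phase.dilation, Phase.scale, centredForm, Fintype.card_subtype_compl, hP]
  have hpow : r ^ (d - 1) = r ^ (m - 1) * r ^ (d - m) := by
    rw [← pow_add]; congr 1; lia
  rw [NormalForm.growth, hdil, hpow, mul_inv_cancel_right₀ (pow_pos hr _).ne']
  simp [centredForm, mul_comm lam₁]

end Centred

end Spectrum

section LeadingRotation

open scoped InnerProductSpace

variable {ι : Type*} [Fintype ι] (P : ι → Prop) [DecidablePred P] (tau : ι → ℝ)

/-- The norm `γ` of the restriction of the linear term to the leading eigenspace. -/
def leadingSlope : ℝ := √(∑ i with P i, tau i ^ 2)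

/-- The unit vector along the restriction of the linear term to the leading eigenspace. -/
def leadingDirection : EuclideanSpace ℝ ι :=
  WithLp.toLp 2 fun i => if P i then tau i / leadingSlope P tau else 0

variable {P tau}

theorem leadingSlope_pos {p : ι} (hp : P p) (hτ : tau p ≠ 0) : 0 < leadingSlope P tau :=
  Real.sqrt_pos.2 <| Finset.sum_pos' (fun _ _ => sq_nonneg _) ⟨p, by simpa using hp, by positivity⟩

theorem leadingDirection_apply_of_pos {j : ι} (hj : P j) :
    leadingDirection P tau j = tau j / leadingSlope P tau := if_pos hj

theorem leadingDirection_apply_eq_zero {j : ι} (hj : P j → tau j = 0) :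
    leadingDirection P tau j = 0 := by
  by_cases h : P j
  · rw [leadingDirection_apply_of_pos h, hj h, zero_div]
  · exact if_neg h

theorem inner_leadingDirection (x : EuclideanSpace ℝ ι) :
    ⟪leadingDirection P tau, x⟫_ℝ = (∑ i with P i, tau i * x i) / leadingSlope P tau := by
  simp only [PiLp.inner_apply, leadingDirection, RCLike.inner_apply, conj_trivial, mul_ite,
    mul_zero, Finset.sum_filter, Finset.sum_div]
  refine Finset.sum_congr rfl fun i _ => ?_
  split_ifs <;> ring

theorem norm_leadingDirection (hslope : 0 < leadingSlope P tau) :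
    ‖leadingDirection P tau‖ = 1 := by
  have hsq : leadingSlope P tau ^ 2 = ∑ i with P i, tau i ^ 2 :=
    Real.sq_sqrt (Finset.sum_nonneg fun _ _ => sq_nonneg _)
  have hentry : ∀ i, leadingDirection P tau i ^ 2 =
      if P i then tau i ^ 2 / leadingSlope P tau ^ 2 else 0 := fun i => by
    simp only [leadingDirection]
    split_ifs <;> ring
  rw [← sq_eq_sq₀ (norm_nonneg _) zero_le_one, EuclideanSpace.real_norm_sq_eq,
    Finset.sum_congr rfl fun i _ => hentry i, ← Finset.sum_filter, ← Finset.sum_div, ← hsq,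
    div_self (pow_pos hslope 2).ne', one_pow]

variable [DecidableEq ι] (P tau)

/-- The reflection exchanging the coordinate vector `p` and the leading direction. -/
def leadingRotation (p : ι) : EuclideanSpace ℝ ι ≃ₗᵢ[ℝ] EuclideanSpace ℝ ι :=
  (ℝ ∙ (EuclideanSpace.single p (1 : ℝ) - leadingDirection P tau))ᗮ.reflection

variable {P tau} {p : ι}

theorem leadingRotation_single (hslope : 0 < leadingSlope P tau) :
    leadingRotation P tau p (EuclideanSpace.single p 1) = leadingDirection P tau :=
  Submodule.reflection_sub (by rw [norm_leadingDirection hslope, PiLp.norm_single, norm_one])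

theorem inner_leadingRotation (x y : EuclideanSpace ℝ ι) :
    ⟪x, leadingRotation P tau p y⟫_ℝ = ⟪leadingRotation P tau p x, y⟫_ℝ := by
  rw [real_inner_comm, LinearIsometryEquiv.inner_map_eq_flip, leadingRotation,
    Submodule.reflection_symm, real_inner_comm]

theorem leadingRotation_apply_of_ne {j : ι} (hjp : j ≠ p) (hj : P j → tau j = 0)
    (x : EuclideanSpace ℝ ι) : leadingRotation P tau p x j = x j := by
  have hfix : leadingRotation P tau p (EuclideanSpace.single j 1) = EuclideanSpace.single j 1 := by
    refine Submodule.reflection_mem_subspace_eq_self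
      (Submodule.mem_orthogonal_singleton_iff_inner_right.2 ?_)
    simp [EuclideanSpace.inner_single_right, leadingDirection_apply_eq_zero hj, hjp]
  have hcoord : ∀ y : EuclideanSpace ℝ ι, ⟪EuclideanSpace.single j 1, y⟫_ℝ = y j := fun y => by
    simp [EuclideanSpace.inner_single_left]
  rw [← hcoord, inner_leadingRotation, hfix, hcoord]

theorem sum_mul_leadingRotation (hslope : 0 < leadingSlope P tau) (x : EuclideanSpace ℝ ι) :
    ∑ i with P i, tau i * leadingRotation P tau p x i = leadingSlope P tau * x p := by
  have hinner : ⟪leadingDirection P tau, leadingRotation P tau p x⟫_ℝ = x p := by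
    rw [inner_leadingRotation, ← leadingRotation_single hslope (p := p), leadingRotation,
      Submodule.reflection_reflection]
    simp [EuclideanSpace.inner_single_left]
  rw [← hinner, inner_leadingDirection, mul_div_cancel₀ _ hslope.ne']

end LeadingRotation

section Shifted

variable {d m : ℕ} {P : Fin d → Prop} [DecidablePred P] {lam tau : Fin d → ℝ} {lam₁ : ℝ}
  {p : Fin d} (hp : P p) (hτ : tau p ≠ 0) (heq : ∀ i, P i → lam i = lam₁)
  (hlt : ∀ i, ¬ P i → lam i < lam₁)

include hp hτ heq in
theorem exponent_leadingRotation (x : EuclideanSpace ℝ (Fin d)) :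
    exponent lam tau (leadingRotation P tau p x) = lam₁ * ‖x‖ ^ 2 + (leadingSlope P tau * x p +
      ∑ i with ¬ P i, (-(lam₁ - lam i) * x i ^ 2 + tau i * x i)) := by
  rw [exponent_eq_of_forall_eq heq, sum_mul_leadingRotation (leadingSlope_pos hp hτ),
    LinearIsometryEquiv.norm_map]
  congr 2
  refine Finset.sum_congr rfl fun i hi => ?_
  have hi' := (Finset.mem_filter.1 hi).2
  rw [leadingRotation_apply_of_ne (by rintro rfl; exact hi' hp) fun h => absurd h hi']

/-- The normal form when the linear term does not vanish at the coordinate `p` of the leading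
eigenspace, whose unit sphere then contributes only at the leading direction. -/
def shiftedForm : NormalForm lam tau (· = p) where
  pole := ⟨p, rfl⟩
  γ := leadingSlope P tau
  κ i := if P i then leadingSlope P tau / 2 else lam₁ - lam i
  ν i := if P i then 0 else tau i
  tangential i := P i
  γ_nonneg := Real.sqrt_nonneg _
  κ_pos i := by
    have hslope := leadingSlope_pos hp hτ
    split_ifs with hi
    exacts [half_pos hslope, sub_pos.2 (hlt i hi)]
  κ_of_tangential _ hi := if_pos hi
  ν_of_tangential _ hi := if_pos hi
  Λ := lam₁
  rotation := leadingRotation P tau p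
  exponent_rotation x := by
    have hsum := sum_subtype_ne_ite hp (0 : ℝ) fun i => -(lam₁ - lam i) * x i ^ 2 + tau i * x i
    rw [smul_zero, zero_add] at hsum
    rw [exponent_leadingRotation hp hτ heq, ← hsum]
    congr 2
    refine Finset.sum_congr rfl fun i _ => ?_
    by_cases hi : P i <;> simp [hi]

theorem gaussMass_shiftedForm (hP : Fintype.card {i // P i} = m) :
    gaussMass (shiftedForm hp hτ heq hlt).κ (shiftedForm hp hτ heq hlt).ν =
      √(2 * Real.pi / leadingSlope P tau) ^ (m - 1) * transversalMass P lam tau lam₁ := by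
  rw [transversalMass, ← hP, ← prod_subtype_ne_ite hp]
  refine Finset.prod_congr rfl fun i _ => ?_
  by_cases hi : P i
  · simp [shiftedForm, hi, div_div_eq_mul_div, mul_comm]
  · simp [shiftedForm, hi]

theorem angularMass_shiftedForm : (shiftedForm hp hτ heq hlt).angularMass = 1 := by
  have hweight : ∀ θ, (shiftedForm hp hτ heq hlt).angularWeight θ =
      if θ (default : {i // i = p}) = 1 then 1 else 0 := fun θ => by
    have hslope := (leadingSlope_pos hp hτ).ne'
    simp only [Phase.angularWeight, shiftedForm, hslope, false_or]
    rfl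
  simp only [NormalForm.angularMass, hweight, integral_surfaceMeasure_ite_of_unique]

theorem growth_shiftedForm (hP : Fintype.card {i // P i} = m) {r : ℝ} (hr : 0 < r) :
    (shiftedForm hp hτ heq hlt).growth r =
      √r ^ (m - 1) * Real.exp (r ^ 2 * lam₁ + r * leadingSlope P tau) := by
  have hscale : ∏ i, (shiftedForm hp hτ heq hlt).scale r i = √r ^ (m - 1) := by
    refine (prod_subtype_ne_ite (P := P) hp √r fun _ => 1).trans ?_
    rw [hP, Finset.prod_const_one, mul_one]
  have hcard : Fintype.card {i : Fin d // ¬ i = p} = d - 1 := by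
    simp [Fintype.card_subtype_compl]
  rw [NormalForm.growth]
  simp only [Phase.dilation]
  rw [Finset.prod_div_distrib, hscale, Finset.prod_const, Finset.card_univ, hcard,
    mul_div_cancel₀ _ (pow_pos hr _).ne', add_comm, mul_comm _ r, mul_comm _ (r ^ 2)]
  rfl

end Shifted

namespace NormalForm

variable {d : ℕ} {lam tau : Fin d → ℝ} {P : Fin d → Prop} [DecidablePred P]
  {N : NormalForm lam tau P} (hmass : N.angularMass ≠ 0) {j : {i // ¬ P i}}
  (hj : ∀ x, N.rotation x j = x j)
include hmass hj

theorem isEquivalent_derivTau_of_fixed (hν : N.ν j ≠ 0) :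
    derivTau lam tau j ~[atTop] fun r =>
      N.scale r j * (N.ν j / (2 * N.κ j)) * integral lam tau r :=
  isEquivalent_derivTau hmass (fun _ hr => (N.scale_pos j hr).ne')
    (div_ne_zero hν (mul_pos two_pos (N.κ_pos j)).ne') (tendsto_moment_coord_div_growth hj)

theorem isEquivalent_derivLam_of_fixed :
    derivLam lam tau j ~[atTop] fun r =>
      N.scale r j ^ 2 * (1 / (2 * N.κ j) + N.ν j ^ 2 / (4 * N.κ j ^ 2)) * integral lam tau r :=
  have hκ := N.κ_pos j
  isEquivalent_derivLam hmass (fun _ hr => (N.scale_pos j hr).ne') (by positivity)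
    (tendsto_moment_coord_sq_div_growth hj)

end NormalForm

section Asymptotics

variable {d m : ℕ} {P : Fin d → Prop} [DecidablePred P] {lam tau : Fin d → ℝ} {lam₁ : ℝ}

section Centred

variable (hm : 1 ≤ m) (hP : Fintype.card {i // P i} = m) (heq : ∀ i, P i → lam i = lam₁)
  (hlt : ∀ i, ¬ P i → lam i < lam₁) (hτ : ∀ i, P i → tau i = 0)
include hm hP heq hlt hτ

theorem isEquivalent_integral_of_forall_eq_zero :
    integral lam tau ~[atTop] fun r => r ^ (m - 1) * unitSphereVolume m *
      Real.exp (r ^ 2 * lam₁ - ∑ i with ¬ P i, tau i ^ 2 / (4 * (lam i - lam₁))) *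
      (Real.pi ^ (((d : ℝ) - m) / 2) / ∏ i with ¬ P i, √(lam₁ - lam i)) := by
  obtain ⟨p⟩ : Nonempty {i // P i} := Fintype.card_pos_iff.1 (hP ▸ hm)
  have hmass := angularMass_centredForm p heq hlt hτ hP
  refine (NormalForm.isEquivalent_integral
    (hmass ▸ (unitSphereVolume_pos hm).ne')).congr_right ?_
  filter_upwards [eventually_gt_atTop 0] with r hr
  rw [hmass, gaussMass_centredForm, growth_centredForm p heq hlt hτ hP hr, transversalMass_eq hP,
    Real.exp_sub, Real.exp_neg]
  ring

theorem isEquivalent_derivLam_of_forall_eq_zero {j : Fin d} (hj : P j) :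
    derivLam lam tau j ~[atTop] fun r => r ^ 2 / m * integral lam tau r := by
  have : Nonempty {i // P i} := ⟨⟨j, hj⟩⟩
  set N := centredForm ⟨j, hj⟩ heq hlt hτ
  have hmass : N.angularMass = unitSphereVolume m := angularMass_centredForm _ heq hlt hτ hP
  have hangular : ∫ θ, N.angularWeight θ *
      N.rotation (join (θ : EuclideanSpace ℝ {i // P i}) 0) j ^ 2 ∂surfaceMeasure {i // P i} =
        1 / m * N.angularMass := by
    have hintegrand : ∀ θ : EuclideanSpace ℝ {i // P i},
        N.angularWeight θ * N.rotation (join θ 0) j ^ 2 = θ ⟨j, hj⟩ ^ 2 := fun θ => by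
      rw [Phase.angularWeight, if_pos (.inl rfl), one_mul, ← join_apply_of_pos θ 0 hj]
      rfl
    simp only [hintegrand, integral_surfaceMeasure_apply_sq, hP, hmass]
    ring
  have hlim := N.tendsto_moment_pow_div_growth j 2
  rw [hangular, mul_assoc] at hlim
  have h := NormalForm.isEquivalent_derivLam (hmass ▸ (unitSphereVolume_pos hm).ne')
    (s := fun r => r) (fun _ hr => hr.ne') (one_div_ne_zero (by positivity)) hlim
  simpa only [mul_one_div] using h

end Centred

section Shifted

variable (hP : Fintype.card {i // P i} = m) {p : Fin d} (hp : P p) (hτ : tau p ≠ 0)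
  (heq : ∀ i, P i → lam i = lam₁) (hlt : ∀ i, ¬ P i → lam i < lam₁)

include hP hp hτ heq hlt in
theorem isEquivalent_integral_of_ne_zero :
    integral lam tau ~[atTop] fun r =>
      Real.exp (r ^ 2 * lam₁ + r * leadingSlope P tau -
          ∑ i with ¬ P i, tau i ^ 2 / (4 * (lam i - lam₁))) *
        (2 * r / leadingSlope P tau) ^ (((m : ℝ) - 1) / 2) *
        (Real.pi ^ (((d : ℝ) - 1) / 2) / ∏ i with ¬ P i, √(lam₁ - lam i)) := by
  have hmass := angularMass_shiftedForm hp hτ heq hlt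
  have hslope := leadingSlope_pos hp hτ
  have hm : 1 ≤ m := hP ▸ Fintype.card_pos_iff.2 ⟨⟨p, hp⟩⟩
  refine (NormalForm.isEquivalent_integral (hmass ▸ one_ne_zero)).congr_right ?_
  filter_upwards [eventually_gt_atTop 0] with r hr
  have hpow : √(2 * Real.pi / leadingSlope P tau) ^ (m - 1) * √r ^ (m - 1) =
      (2 * r / leadingSlope P tau) ^ (((m : ℝ) - 1) / 2) * Real.pi ^ (((m : ℝ) - 1) / 2) := by
    rw [← mul_pow, ← Real.sqrt_mul (by positivity), sqrt_pow_eq_rpow (by positivity),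
      ← Real.mul_rpow (by positivity) Real.pi_pos.le, Nat.cast_pred hm]
    congr 1
    ring
  have hpi : Real.pi ^ (((d : ℝ) - 1) / 2) =
      Real.pi ^ (((m : ℝ) - 1) / 2) * Real.pi ^ (((d : ℝ) - m) / 2) := by
    rw [← Real.rpow_add Real.pi_pos]
    congr 1
    ring
  rw [hmass, gaussMass_shiftedForm hp hτ heq hlt hP, growth_shiftedForm hp hτ heq hlt hP hr,
    transversalMass_eq hP, hpi, Real.exp_sub, Real.exp_neg]
  linear_combination (Real.exp (r ^ 2 * lam₁ + r * leadingSlope P tau) *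
    (Real.exp (∑ i with ¬ P i, tau i ^ 2 / (4 * (lam i - lam₁))))⁻¹ *
    (Real.pi ^ (((d : ℝ) - m) / 2) / ∏ i with ¬ P i, √(lam₁ - lam i))) * hpow

theorem tendsto_moment_pow_div_growth_shiftedForm (j : Fin d) (n : ℕ) :
    Tendsto (fun r => moment lam tau (fun t => (t j / r) ^ n) r /
        (shiftedForm hp hτ heq hlt).growth r) atTop
      (𝓝 (leadingDirection P tau j ^ n * ((shiftedForm hp hτ heq hlt).angularMass *
        gaussMass (shiftedForm hp hτ heq hlt).κ (shiftedForm hp hτ heq hlt).ν))) := by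
  set N := shiftedForm hp hτ heq hlt
  have hslope := leadingSlope_pos hp hτ
  have hintegrand : ∀ θ : EuclideanSpace ℝ {i // i = p},
      N.angularWeight θ * N.rotation (join θ 0) j ^ n =
        leadingDirection P tau j ^ n * N.angularWeight θ := fun θ => by
    by_cases hθ : θ ⟨p, rfl⟩ = 1
    · have hjoin : join θ 0 = EuclideanSpace.single p 1 := by
        ext i
        by_cases hi : i = p
        · subst hi
          simp [join_apply_of_pos, hθ]
        · exact (join_apply_of_neg θ 0 hi).trans (by simp [hi])
      have hpole : N.rotation (EuclideanSpace.single p 1) = leadingDirection P tau :=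
        leadingRotation_single hslope
      rw [hjoin, hpole, mul_comm]
    · rw [show N.angularWeight θ = 0 from if_neg (not_or.2 ⟨hslope.ne', hθ⟩), zero_mul, mul_zero]
  have h := N.tendsto_moment_pow_div_growth j n
  simp only [hintegrand, integral_const_mul, mul_assoc] at h
  exact h

include hp hτ heq hlt

theorem isEquivalent_derivTau_of_ne_zero :
    derivTau lam tau p ~[atTop] fun r =>
      r * (tau p / leadingSlope P tau) * integral lam tau r := by
  have hlim := tendsto_moment_pow_div_growth_shiftedForm hp hτ heq hlt p 1
  simp only [pow_one, leadingDirection_apply_of_pos hp] at hlim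
  exact NormalForm.isEquivalent_derivTau
    (angularMass_shiftedForm hp hτ heq hlt ▸ one_ne_zero) (fun _ hr => hr.ne')
    (div_ne_zero hτ (leadingSlope_pos hp hτ).ne') hlim

theorem isEquivalent_derivLam_of_ne_zero :
    derivLam lam tau p ~[atTop] fun r =>
      r ^ 2 * (tau p ^ 2 / leadingSlope P tau ^ 2) * integral lam tau r := by
  have hlim := tendsto_moment_pow_div_growth_shiftedForm hp hτ heq hlt p 2
  rw [leadingDirection_apply_of_pos hp, div_pow] at hlim
  exact NormalForm.isEquivalent_derivLam
    (angularMass_shiftedForm hp hτ heq hlt ▸ one_ne_zero) (fun _ hr => hr.ne')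
    (div_ne_zero (pow_ne_zero 2 hτ) (pow_pos (leadingSlope_pos hp hτ) 2).ne') hlim

theorem isEquivalent_derivLam_of_eq_zero {j : Fin d} (hj : P j) (hτj : tau j = 0) :
    derivLam lam tau j ~[atTop] fun r => r / leadingSlope P tau * integral lam tau r := by
  have hjp : j ≠ p := by rintro rfl; exact hτ hτj
  set N := shiftedForm hp hτ heq hlt
  have h := NormalForm.isEquivalent_derivLam_of_fixed (N := N) (j := ⟨j, hjp⟩)
    (angularMass_shiftedForm hp hτ heq hlt ▸ one_ne_zero)
    (leadingRotation_apply_of_ne hjp fun _ => hτj)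
  refine h.congr_right ?_
  filter_upwards [eventually_gt_atTop 0] with r hr
  rw [N.scale_of_tangential (i := ⟨j, hjp⟩) hj, N.κ_of_tangential ⟨j, hjp⟩ hj,
    N.ν_of_tangential ⟨j, hjp⟩ hj, Real.sq_sqrt hr.le, show N.γ = leadingSlope P tau from rfl]
  field_simp [(leadingSlope_pos hp hτ).ne']
  ring

end Shifted

section Transversal

variable (hP : ∃ i, P i) (heq : ∀ i, P i → lam i = lam₁) (hlt : ∀ i, ¬ P i → lam i < lam₁)
  {j : Fin d} (hj : ¬ P j)
omit [DecidablePred P]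
include hP heq hlt hj

theorem exists_normalForm_transversal :
    ∃ (Q : Fin d → Prop) (_ : DecidablePred Q) (N : NormalForm lam tau Q) (k : {i // ¬ Q i}),
      N.angularMass ≠ 0 ∧ (k : Fin d) = j ∧ (∀ x, N.rotation x k = x k) ∧
      (∀ r, N.scale r k = 1) ∧ N.κ k = lam₁ - lam j ∧ N.ν k = tau j := by
  classical
  by_cases hτ : ∀ i, P i → tau i = 0
  · obtain ⟨p, hp⟩ := hP
    refine ⟨P, inferInstance, centredForm ⟨p, hp⟩ heq hlt hτ, ⟨j, hj⟩, ?_, rfl, fun _ => rfl,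
      fun _ => if_neg id, rfl, rfl⟩
    rw [angularMass_centredForm _ heq hlt hτ rfl]
    exact (unitSphereVolume_pos (Fintype.card_pos_iff.2 ⟨⟨p, hp⟩⟩)).ne'
  · push Not at hτ
    obtain ⟨p, hp, hτp⟩ := hτ
    have hjp : j ≠ p := by rintro rfl; exact hj hp
    exact ⟨(· = p), inferInstance, shiftedForm hp hτp heq hlt, ⟨j, hjp⟩,
      angularMass_shiftedForm hp hτp heq hlt ▸ one_ne_zero, rfl,
      leadingRotation_apply_of_ne hjp fun h => absurd h hj, fun _ => if_neg hj,
      if_neg hj, if_neg hj⟩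

theorem isEquivalent_derivTau_of_not :
    derivTau lam tau j ~[atTop] fun r =>
      -(tau j / (2 * (lam j - lam₁))) * integral lam tau r := by
  by_cases hτ : tau j = 0
  · simp only [hτ, zero_div, neg_zero, zero_mul]
    exact IsEquivalent.refl.congr_left ((eventually_gt_atTop 0).mono fun r hr =>
      (derivTau_eq_zero hτ hr).symm)
  · obtain ⟨Q, _, N, k, hmass, rfl, hfix, hscale, hκ, hν⟩ :=
      exists_normalForm_transversal (tau := tau) hP heq hlt hj
    have h := NormalForm.isEquivalent_derivTau_of_fixed hmass hfix (hν ▸ hτ)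
    simpa only [hscale, one_mul, hκ, hν, ← div_neg, ← mul_neg, neg_sub] using h

theorem isEquivalent_derivLam_of_not :
    derivLam lam tau j ~[atTop] fun r =>
      (1 / (2 * (lam₁ - lam j)) + tau j ^ 2 / (4 * (lam j - lam₁) ^ 2)) *
        integral lam tau r := by
  obtain ⟨Q, _, N, k, hmass, rfl, hfix, hscale, hκ, hν⟩ :=
    exists_normalForm_transversal (tau := tau) hP heq hlt hj
  have h := NormalForm.isEquivalent_derivLam_of_fixed hmass hfix
  simpa only [hscale, one_pow, one_mul, hκ, hν, sub_sq_comm lam₁] using h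

end Transversal

end Asymptotics

end FisherBingham

end

open FisherBingham in
theorem proposition2_general {d m : ℕ} (hm : 1 ≤ m) {P : Fin d → Prop} [DecidablePred P]
    (hP : Fintype.card {i // P i} = m) (lam tau : Fin d → ℝ) (lam₁ : ℝ)
    (heq : ∀ i, P i → lam i = lam₁) (hlt : ∀ i, ¬ P i → lam i < lam₁) :
    (∀ r : ℝ, 0 < r → ∀ j,
      DifferentiableAt ℝ (fun s => integral (Function.update lam j s) tau r) (lam j) ∧
      DifferentiableAt ℝ (fun s => integral lam (Function.update tau j s) r) (tau j)) ∧
    ((∀ i, P i → tau i = 0) →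
      (integral lam tau ~[atTop] fun r =>
        r ^ (m - 1) * unitSphereVolume m *
          Real.exp (r ^ 2 * lam₁ - ∑ i with ¬ P i, tau i ^ 2 / (4 * (lam i - lam₁))) *
          (Real.pi ^ (((d : ℝ) - m) / 2) / ∏ i with ¬ P i, √(lam₁ - lam i))) ∧
      (∀ j, P j → derivLam lam tau j ~[atTop] fun r => r ^ 2 / m * integral lam tau r) ∧
      (∀ j, P j → ∀ r : ℝ, 0 < r → derivTau lam tau j r = 0) ∧
      (∀ j, ¬ P j → derivTau lam tau j ~[atTop] fun r =>
        -(tau j / (2 * (lam j - lam₁))) * integral lam tau r) ∧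
      (∀ j, ¬ P j → derivLam lam tau j ~[atTop] fun r =>
        (1 / (2 * (lam₁ - lam j)) + tau j ^ 2 / (4 * (lam j - lam₁) ^ 2)) *
          integral lam tau r)) ∧
    ((∃ i, P i ∧ tau i ≠ 0) → ∀ γ : ℝ, γ = √(∑ i with P i, tau i ^ 2) →
      (integral lam tau ~[atTop] fun r =>
        Real.exp (r ^ 2 * lam₁ + r * γ - ∑ i with ¬ P i, tau i ^ 2 / (4 * (lam i - lam₁))) *
          (2 * r / γ) ^ (((m : ℝ) - 1) / 2) *
          (Real.pi ^ (((d : ℝ) - 1) / 2) / ∏ i with ¬ P i, √(lam₁ - lam i))) ∧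
      (∀ j, P j → tau j ≠ 0 → derivTau lam tau j ~[atTop] fun r =>
        r * (tau j / γ) * integral lam tau r) ∧
      (∀ j, P j → tau j ≠ 0 → derivLam lam tau j ~[atTop] fun r =>
        r ^ 2 * (tau j ^ 2 / γ ^ 2) * integral lam tau r) ∧
      (∀ j, P j → tau j = 0 → ∀ r : ℝ, 0 < r → derivTau lam tau j r = 0) ∧
      (∀ j, P j → tau j = 0 → derivLam lam tau j ~[atTop] fun r =>
        r / γ * integral lam tau r) ∧
      (∀ j, ¬ P j → derivTau lam tau j ~[atTop] fun r =>
        -(tau j / (2 * (lam j - lam₁))) * integral lam tau r) ∧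
      (∀ j, ¬ P j → derivLam lam tau j ~[atTop] fun r =>
        (1 / (2 * (lam₁ - lam j)) + tau j ^ 2 / (4 * (lam j - lam₁) ^ 2)) *
          integral lam tau r)) := by
  have hne : ∃ i, P i := nonempty_subtype.1 (Fintype.card_pos_iff.1 (hP ▸ hm))
  have hderivTau := fun j (hj : ¬ P j) => isEquivalent_derivTau_of_not (tau := tau) hne heq hlt hj
  have hderivLam := fun j (hj : ¬ P j) => isEquivalent_derivLam_of_not (tau := tau) hne heq hlt hj
  refine ⟨fun r hr j => ⟨(hasDerivAt_integral_lam lam tau j hr).differentiableAt,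
    (hasDerivAt_integral_tau lam tau j hr).differentiableAt⟩, fun hτ =>
    ⟨isEquivalent_integral_of_forall_eq_zero hm hP heq hlt hτ,
      fun j => isEquivalent_derivLam_of_forall_eq_zero hm hP heq hlt hτ,
      fun j hj r => derivTau_eq_zero (hτ j hj), hderivTau, hderivLam⟩, ?_⟩
  rintro ⟨p, hp, hτ⟩ γ rfl
  exact ⟨isEquivalent_integral_of_ne_zero hP hp hτ heq hlt,
    fun j hj hτj => isEquivalent_derivTau_of_ne_zero hj hτj heq hlt,
    fun j hj hτj => isEquivalent_derivLam_of_ne_zero hj hτj heq hlt,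
    fun j _ hτj r => derivTau_eq_zero hτj,
    fun j => isEquivalent_derivLam_of_eq_zero hp hτ heq hlt, hderivTau, hderivLam⟩

theorem proposition2 {d m : ℕ} (hm : 1 ≤ m) (hmd : m ≤ d) (lam tau : Fin d → ℝ) (lam₁ : ℝ)
    (hneg : lam₁ < 0)
    (heq : ∀ i : Fin d, (i : ℕ) < m → lam i = lam₁)
    (hlt : ∀ i : Fin d, m ≤ (i : ℕ) → lam i < lam₁)
    (hanti : Antitone lam) :
    -- the partial derivatives exist
    (∀ r : ℝ, 0 < r → ∀ j : Fin d,
      DifferentiableAt ℝ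
        (fun s => FisherBingham.integral (Function.update lam j s) tau r) (lam j) ∧
      DifferentiableAt ℝ
        (fun s => FisherBingham.integral lam (Function.update tau j s) r) (tau j)) ∧
    -- the case `τ_1 = ⋯ = τ_m = 0`
    ((∀ i : Fin d, (i : ℕ) < m → tau i = 0) →
      (FisherBingham.integral lam tau ~[atTop] fun r =>
        r ^ (m - 1) * FisherBingham.unitSphereVolume m *
          Real.exp (r ^ 2 * lam₁ -
            ∑ i ∈ Finset.univ.filter (fun i : Fin d => m ≤ (i : ℕ)),
              tau i ^ 2 / (4 * (lam i - lam₁))) *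
          (Real.pi ^ (((d : ℝ) - m) / 2) /
            ∏ i ∈ Finset.univ.filter (fun i : Fin d => m ≤ (i : ℕ)),
              Real.sqrt (lam₁ - lam i))) ∧
      (∀ j : Fin d, (j : ℕ) < m →
        FisherBingham.derivLam lam tau j ~[atTop] fun r =>
          r ^ 2 / m * FisherBingham.integral lam tau r) ∧
      (∀ j : Fin d, (j : ℕ) < m → ∀ r : ℝ, 0 < r →
        FisherBingham.derivTau lam tau j r = 0) ∧
      (∀ j : Fin d, m ≤ (j : ℕ) →
        FisherBingham.derivTau lam tau j ~[atTop] fun r =>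
          -(tau j / (2 * (lam j - lam₁))) * FisherBingham.integral lam tau r) ∧
      (∀ j : Fin d, m ≤ (j : ℕ) →
        FisherBingham.derivLam lam tau j ~[atTop] fun r =>
          (1 / (2 * (lam₁ - lam j)) + tau j ^ 2 / (4 * (lam j - lam₁) ^ 2)) *
            FisherBingham.integral lam tau r)) ∧
    -- the case `(τ_1, …, τ_m) ≠ (0, …, 0)`
    ((∃ i : Fin d, (i : ℕ) < m ∧ tau i ≠ 0) →
      ∀ γ : ℝ, γ = Real.sqrt (∑ i ∈ Finset.univ.filter (fun i : Fin d => (i : ℕ) < m), tau i ^ 2) →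
      (FisherBingham.integral lam tau ~[atTop] fun r =>
        Real.exp (r ^ 2 * lam₁ + r * γ -
            ∑ i ∈ Finset.univ.filter (fun i : Fin d => m ≤ (i : ℕ)),
              tau i ^ 2 / (4 * (lam i - lam₁))) *
          (2 * r / γ) ^ (((m : ℝ) - 1) / 2) *
          (Real.pi ^ (((d : ℝ) - 1) / 2) /
            ∏ i ∈ Finset.univ.filter (fun i : Fin d => m ≤ (i : ℕ)),
              Real.sqrt (lam₁ - lam i))) ∧
      (∀ j : Fin d, (j : ℕ) < m → tau j ≠ 0 →
        FisherBingham.derivTau lam tau j ~[atTop] fun r =>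
          r * (tau j / γ) * FisherBingham.integral lam tau r) ∧
      (∀ j : Fin d, (j : ℕ) < m → tau j ≠ 0 →
        FisherBingham.derivLam lam tau j ~[atTop] fun r =>
          r ^ 2 * (tau j ^ 2 / γ ^ 2) * FisherBingham.integral lam tau r) ∧
      (∀ j : Fin d, (j : ℕ) < m → tau j = 0 → ∀ r : ℝ, 0 < r →
        FisherBingham.derivTau lam tau j r = 0) ∧
      (∀ j : Fin d, (j : ℕ) < m → tau j = 0 →
        FisherBingham.derivLam lam tau j ~[atTop] fun r =>
          r / γ * FisherBingham.integral lam tau r) ∧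
      (∀ j : Fin d, m ≤ (j : ℕ) →
        FisherBingham.derivTau lam tau j ~[atTop] fun r =>
          -(tau j / (2 * (lam j - lam₁))) * FisherBingham.integral lam tau r) ∧
      (∀ j : Fin d, m ≤ (j : ℕ) →
        FisherBingham.derivLam lam tau j ~[atTop] fun r =>
          (1 / (2 * (lam₁ - lam j)) + tau j ^ 2 / (4 * (lam j - lam₁) ^ 2)) *
            FisherBingham.integral lam tau r)) := by
  simpa only [not_lt] using proposition2_general hm (P := fun i : Fin d => (i : ℕ) < m)
    (by rw [Fintype.card_subtype, Fin.card_filter_val_lt, min_eq_right hmd]) lam tau lam₁ heq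
    (by simpa only [not_lt] using hlt)
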